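/- **Setting.** For $b=(b_1,b_2,b_3,b_4)\in\mathbb R^4$ put $$Q(b)=4b_1b_2b_3b_4-\left(b_1+b_2+b_3+b_4-1-b_1b_4-b_2b_3\right)^2,\qquad \Omega=\{b: b_1\ge 0,\ b_2\ge 0,\ b_1+b_2\le 1,\ Q(b)\ge 0\}.$$ The set $\Omega$ parametrizes (up to a set of Lebesgue measure zero) the unistochastic matrices $B$ of order three, $B_{ij}=|U_{ij}|^2$ with $U\in U(3)$, through $b_1=B_{11}$, $b_2=B_{12}$, $b_3=B_{21}$, $b_4=B_{22}$. The Jarlskog invariant of $U\in U(3)$ is $J(U)=\operatorname{Im}(U_{11}U_{22}\overline{U_{12}}\,\overline{U_{21}})$; it satisfies $J(U)^2=Q(b)/4$, and for $b\in\Omega$ one writes $|J|=\tfrac12\sqrt{Q(b)}$. For real $k>\frac12$ let $\mu_k$ be the measure $h_k^{-1}Q(b)^{k-3/2}\,db$ on $\Omega$, where $db$ is Lebesgue measure and $h_k=\int_\Omega Q(b)^{k-3/2}\,db$, and let $P_k$ denote probability under $\mu_k$. Write $(x)_n=x(x+1)\cdots(x+n-1)$ and $c_k=\Gamma(k+\frac13)\Gamma(k+\frac23)/\Gamma(k)^2$.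 **Theorem.** (1) For every real $k>\frac12$, $\mu_k$ is a probability measure, and for every $0<x\le 1$ $$P_k\{6\sqrt3\,|J|\le x\}=P_k\{6\sqrt3\,|J|<x\}=2c_k\left(k-\tfrac12\right)x^{2k-1}\left\{\frac{3}{2k-1}-\frac{\sqrt3}{2\pi}\sum_{n=0}^\infty\frac{(\frac13)_n(\frac23)_n\,x^{2n+1}}{n!\,n!\,(2n+1)(n+k)}\left(-\ln\frac{x^2}{27}-\sum_{j=n+1}^{3n}\frac3j+\frac{2}{2n+1}+\frac1{n+k}\right)\right\},$$ the series being absolutely convergent. (2) Let $U$ be distributed according to the normalized Haar measure on $U(3)$. There are real sequences $(a_n)_{n\ge0}$, $(d_n)_{n\ge0}$ with $a_0=1$, $a_1=4$, $a_2=96$, $d_0=-72$, $d_1=128$, $d_2=\frac{24384}{5}$ such that for every $0<y\le\frac1{6\sqrt3}$ the following series converge and $$P\{|J(U)|\le y\}=P_1\{|J|\le y\}=8\pi y+24\ln(4y^2)\sum_{n=0}^\infty a_ny^{2n+2}+\sum_{n=0}^\infty d_ny^{2n+2}.$$ (3) For the flat measure $\mu_{3/2}$ there are real sequences $(a_n)_{n\ge0}$,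 $(d_n)_{n\ge0}$ with $a_0=\frac{1680}{\pi}$, $d_0=-\frac{4480}{\pi}$ such that for every $0<y\le\frac1{6\sqrt3}$ the following series converge and $$P_{3/2}\{|J|\le y\}=420y^2+\ln(4y^2)\sum_{n=0}^\infty a_ny^{2n+3}+\sum_{n=0}^\infty d_ny^{2n+3}.$$ -/

import Mathlib

open MeasureTheory

namespace Jarlskog

noncomputable section

/-- The polynomial `Q(b)`, which is sixteen times the squared area of the unitarity triangle of the
bistochastic matrix with upper left block `(b₁ b₂; b₃ b₄)`; here `b = (b 0, b 1, b 2, b 3)`. -/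
def Q (b : Fin 4 → ℝ) : ℝ :=
  4 * b 0 * b 1 * b 2 * b 3
    - (b 0 + b 1 + b 2 + b 3 - 1 - b 0 * b 3 - b 1 * b 2) ^ 2

/-- The set `Ω ⊆ ℝ⁴` of unistochastic matrices of order three, in the coordinates
`b₁ = B₁₁, b₂ = B₁₂, b₃ = B₂₁, b₄ = B₂₂`. -/
def Omega : Set (Fin 4 → ℝ) :=
  {b | 0 ≤ b 0 ∧ 0 ≤ b 1 ∧ b 0 + b 1 ≤ 1 ∧ 0 ≤ Q b}

/-- The measure `Q(b)^(k - 3/2) db` on `Ω`. -/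
def rawMu (k : ℝ) : Measure (Fin 4 → ℝ) :=
  (volume.restrict Omega).withDensity fun b => ENNReal.ofReal (Q b ^ (k - 3 / 2))

/-- The measure `μ_k`, normalised to total mass one: `h_k⁻¹ Q(b)^(k - 3/2) db` on `Ω`, where
`h_k = ∫_Ω Q(b)^(k - 3/2) db`. -/
def mu (k : ℝ) : Measure (Fin 4 → ℝ) :=
  (rawMu k Set.univ)⁻¹ • rawMu k

/-- The absolute value of the Jarlskog invariant of a unistochastic matrix, from `J² = Q(b) / 4`. -/
def absJ (b : Fin 4 → ℝ) : ℝ := √(Q b) / 2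

/-- The unitary group `U(3)`. -/
abbrev U3 : Type := Matrix.unitaryGroup (Fin 3) ℂ

/-- The Jarlskog invariant `J(U) = Im (U₁₁ U₂₂ U₁₂^* U₂₁^*)` of a unitary matrix of order three. -/
def J (U : U3) : ℝ :=
  ((U : Matrix (Fin 3) (Fin 3) ℂ) 0 0 * (U : Matrix (Fin 3) (Fin 3) ℂ) 1 1
    * star ((U : Matrix (Fin 3) (Fin 3) ℂ) 0 1) * star ((U : Matrix (Fin 3) (Fin 3) ℂ) 1 0)).im

instance : MeasurableSpace U3 := borel U3

instance : BorelSpace U3 := ⟨rfl⟩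

instance : CompactSpace U3 := by
  refine isCompact_iff_compactSpace.mp (IsCompact.of_isClosed_subset
    (s := Set.univ.pi fun _ : Fin 3 => Set.univ.pi fun _ : Fin 3 => Metric.closedBall (0 : ℂ) 1)
    (isCompact_univ_pi fun _ => isCompact_univ_pi fun _ => isCompact_closedBall _ _)
    (isClosed_unitary (R := Matrix (Fin 3) (Fin 3) ℂ)) ?_)
  intro U hU i _ j _
  simpa using entry_norm_bound_of_unitary hU i j

/-- The Haar measure on `U(3)`, normalised to total mass one. -/
def haarU3 : Measure U3 := Measure.haarMeasure ⊤

instance : IsProbabilityMeasure haarU3 := by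
  refine ⟨?_⟩
  have h := Measure.haarMeasure_self (K₀ := (⊤ : TopologicalSpace.PositiveCompacts U3))
  simpa [haarU3] using h

/-- The coordinates `(|U₁₁|², |U₁₂|², |U₂₁|², |U₂₂|²)` of the unistochastic matrix of `U`. -/
def coords (U : U3) : Fin 4 → ℝ :=
  ![‖(U : Matrix (Fin 3) (Fin 3) ℂ) 0 0‖ ^ 2, ‖(U : Matrix (Fin 3) (Fin 3) ℂ) 0 1‖ ^ 2,
    ‖(U : Matrix (Fin 3) (Fin 3) ℂ) 1 0‖ ^ 2, ‖(U : Matrix (Fin 3) (Fin 3) ℂ) 1 1‖ ^ 2]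

/-- The identity `J² = Q / 4` behind the definition of `absJ`. -/
theorem J_sq (U : U3) : J U ^ 2 = Q (coords U) / 4 := by
  have h := Matrix.mem_unitaryGroup_iff.mp U.2
  have h00 := congrFun (congrFun h 0) 0
  have h11 := congrFun (congrFun h 1) 1
  have h01 := congrFun (congrFun h 0) 1
  simp only [Matrix.mul_apply, Matrix.star_apply, Fin.sum_univ_three, Matrix.one_apply_eq] at h00 h11
  simp only [Matrix.mul_apply, Matrix.star_apply, Fin.sum_univ_three,
    Matrix.one_apply_ne (show (0 : Fin 3) ≠ 1 by decide)] at h01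
  simp only [J, Q, coords, Matrix.cons_val, Complex.sq_norm, Complex.normSq_apply]
  generalize (U : Matrix (Fin 3) (Fin 3) ℂ) = V at *
  have e0 := congrArg Complex.re h00
  have e1 := congrArg Complex.re h11
  have er := congrArg Complex.re h01
  have ei := congrArg Complex.im h01
  simp only [Complex.add_re, Complex.add_im, Complex.mul_re, Complex.mul_im, RCLike.star_def,
    Complex.conj_re, Complex.conj_im, Complex.one_re, Complex.zero_re, Complex.zero_im]
    at e0 e1 er ei ⊢
  generalize (V 0 0).re = a, (V 0 0).im = a', (V 0 1).re = b, (V 0 1).im = b',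
    (V 0 2).re = g, (V 0 2).im = g', (V 1 0).re = p, (V 1 0).im = p',
    (V 1 1).re = q, (V 1 1).im = q', (V 1 2).re = r, (V 1 2).im = r' at *
  have k0 : g * g + g' * g' = 1 - (a * a + a' * a') - (b * b + b' * b') := by linarith
  have k1 : r * r + r' * r' = 1 - (p * p + p' * p') - (q * q + q' * q') := by linarith
  have kr : g * r + g' * r' = -(a * p + a' * p' + (b * q + b' * q')) := by linarith
  have ki : g' * r - g * r' = -(a' * p - a * p' + (b' * q - b * q')) := by linarith
  have key : (1 - (a * a + a' * a') - (b * b + b' * b'))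
        * (1 - (p * p + p' * p') - (q * q + q' * q'))
      = (a * p + a' * p' + (b * q + b' * q')) ^ 2
        + (a' * p - a * p' + (b' * q - b * q')) ^ 2 := by
    rw [← k0, ← k1, ← neg_sq (a * p + a' * p' + (b * q + b' * q')), ← kr,
      ← neg_sq (a' * p - a * p' + (b' * q - b * q')), ← ki]
    ring
  have hre : a * a + a' * a' + (b * b + b' * b') + (p * p + p' * p') + (q * q + q' * q') - 1
      - (a * a + a' * a') * (q * q + q' * q') - (b * b + b' * b') * (p * p + p' * p')
      = -2 * ((a * p + a' * p') * (b * q + b' * q') + (a' * p - a * p') * (b' * q - b * q')) := by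
    linear_combination -key
  rw [hre]
  ring

theorem abs_J (U : U3) : |J U| = absJ (coords U) := by
  have h : Q (coords U) = (2 * J U) ^ 2 := by linarith [J_sq U]
  rw [absJ, h, Real.sqrt_sq_eq_abs, abs_mul]
  simp

theorem coords_mem (U : U3) : coords U ∈ Omega := by
  have h := Matrix.mem_unitaryGroup_iff.mp U.2
  have h00 := congrArg Complex.re (congrFun (congrFun h 0) 0)
  simp only [Matrix.mul_apply, Matrix.star_apply, Fin.sum_univ_three, Matrix.one_apply_eq,
    RCLike.star_def, Complex.mul_conj, Complex.normSq_eq_norm_sq] at h00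
  norm_cast at h00
  refine ⟨?_, ?_, ?_, ?_⟩
  · exact sq_nonneg _
  · exact sq_nonneg _
  · have := sq_nonneg ‖(U : Matrix (Fin 3) (Fin 3) ℂ) 0 2‖
    simp only [coords, Matrix.cons_val]
    linarith
  · have := J_sq U
    nlinarith [sq_nonneg (J U)]

/-- The constant `c_k = Γ(k + 1/3) Γ(k + 2/3) / Γ(k)²`. -/
def c (k : ℝ) : ℝ :=
  Real.Gamma (k + 1 / 3) * Real.Gamma (k + 2 / 3) / Real.Gamma k ^ 2

/-- The Pochhammer symbol `(x)_n = x (x + 1) ⋯ (x + n - 1)`. -/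
def poch (x : ℝ) (n : ℕ) : ℝ := ∏ i ∈ Finset.range n, (x + i)

/-- The `n`-th term of the series in the cumulative distribution function. -/
def cdfTerm (k x : ℝ) (n : ℕ) : ℝ :=
  poch (1 / 3) n * poch (2 / 3) n * x ^ (2 * n + 1)
      / ((n.factorial : ℝ) * (n.factorial : ℝ) * (2 * n + 1) * (n + k))
    * (-Real.log (x ^ 2 / 27) - ∑ j ∈ Finset.Icc (n + 1) (3 * n), (3 : ℝ) / (j : ℝ)
        + 2 / (2 * n + 1) + 1 / (n + k))

/-- The explicit cumulative distribution function `F₀(x)` for the parameter `k`. -/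
def cdf (k x : ℝ) : ℝ :=
  2 * c k * (k - 1 / 2) * x ^ (2 * k - 1)
    * (3 / (2 * k - 1) - √3 / (2 * Real.pi) * ∑' n : ℕ, cdfTerm k x n)

end

end Jarlskog

namespace Jarlskog

open Set Real Filter Topology

open scoped ENNReal Matrix

/-! Fix the first row `(x, y)` of the bistochastic matrix and put `m = x y (1 - x - y)`. As a
function of the second row, `Q` is an inverted paraboloid `m (1 - X² - Y²)` in suitable affine
coordinates. Integrating out the second row gives `lintegral_Omega`: under `μ_k`, `Q` is a product
`m t` of independent variables, where `m` has weight `m ^ (k - 1)` on the triangle and `t` has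
weight `t ^ (k - 3/2)` on `(0, 1]`.

It remains to know the law of `27 m` for a uniform point of the triangle. Its moments are Dirichlet
integrals `Γ(s)³ / Γ(3s)`. They satisfy a two-term recurrence in `s` whose density is the
logarithmic solution at `u = 0` of the hypergeometric equation with parameters `1/3, 2/3; 1`. The
series `logSeries` is shown to have the same integer moments by telescoping (`tsum_intTerm_one_one`,
`tsum_intTerm_add_one`), and finite measures on `[0, 1]` are determined by their moments, whence
`map_bary`. The distribution function is then a termwise integral, cut at the threshold `x²`
(`lintegral_min_rpow`). The total mass on the far side is the moment at `s = 1/2`, and Gauss's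
triplication formula turns the normalisation into `c_k`. The expansions in `y` for `k = 1` and `k =
3/2` come from separating the logarithm.

For Haar measure the moments of `J²` are compared with those of `Q / 4` under `μ_1`. Replace the
second row of `U` by a Gaussian combination `z` of the last two rows. By left invariance the average
over `U` produces `‖z‖ ^ (4n)` times the moment of `J`. For fixed `U`, however, the modified
invariant is a traceless Hermitian form in `z` with eigenvalues `±l`, where `4 l²` is the product of
the squared moduli in the first row. Integrating in the two orders yields `E J ^ (2n) = 4⁻ⁿ
E[rowProd ^ n] / (2n + 1)` (`lintegral_J_pow`), and the same trick in `ℂ³` evaluates the row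
average. -/

/-! ### The moment problem on the unit interval. -/

theorem integral_polynomial_eq_of_moments {μ ν : Measure ℝ} [IsFiniteMeasure μ]
    [IsFiniteMeasure ν] (hμ : ∀ᵐ x ∂μ, x ∈ Icc (0 : ℝ) 1) (hν : ∀ᵐ x ∂ν, x ∈ Icc (0 : ℝ) 1)
    (h : ∀ n : ℕ, ∫ x, x ^ n ∂μ = ∫ x, x ^ n ∂ν) (p : Polynomial ℝ) :
    ∫ x, p.eval x ∂μ = ∫ x, p.eval x ∂ν := by
  have key : ∀ ρ : Measure ℝ, IsFiniteMeasure ρ → (∀ᵐ x ∂ρ, x ∈ Icc (0 : ℝ) 1) →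
      ∀ n : ℕ, Integrable (fun x => x ^ n) ρ := by
    intro ρ _ hρ n
    refine Integrable.of_bound (by fun_prop) 1 ?_
    filter_upwards [hρ] with x hx
    rw [Real.norm_eq_abs, abs_of_nonneg (pow_nonneg hx.1 n)]
    exact pow_le_one₀ hx.1 hx.2
  simp_rw [Polynomial.eval_eq_sum_range]
  rw [integral_finsetSum _ fun i _ => (key μ inferInstance hμ i).const_mul _,
    integral_finsetSum _ fun i _ => (key ν inferInstance hν i).const_mul _]
  simp_rw [integral_const_mul, h]

/-- Finite measures on the unit interval with the same moments are equal. -/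
theorem ext_of_moments {μ ν : Measure ℝ} [IsFiniteMeasure μ] [IsFiniteMeasure ν]
    (hμ : ∀ᵐ x ∂μ, x ∈ Icc (0 : ℝ) 1) (hν : ∀ᵐ x ∂ν, x ∈ Icc (0 : ℝ) 1)
    (h : ∀ n : ℕ, ∫⁻ x, ENNReal.ofReal (x ^ n) ∂μ = ∫⁻ x, ENNReal.ofReal (x ^ n) ∂ν) :
    μ = ν := by
  have hm : ∀ n : ℕ, ∫ x, x ^ n ∂μ = ∫ x, x ^ n ∂ν := by
    intro n
    rw [integral_eq_lintegral_of_nonneg_ae _ (by fun_prop),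
      integral_eq_lintegral_of_nonneg_ae _ (by fun_prop), h n]
    · filter_upwards [hν] with x hx using pow_nonneg hx.1 n
    · filter_upwards [hμ] with x hx using pow_nonneg hx.1 n
  refine ext_of_forall_integral_eq_of_IsFiniteMeasure fun f => ?_
  refine eq_of_forall_dist_le fun ε hε => ?_
  -- The summand `1` keeps `K` positive even when both measures vanish.
  set K : ℝ := μ.real univ + ν.real univ + 1 with hK
  have hKpos : 0 < K := by positivity
  obtain ⟨p, hp⟩ := exists_polynomial_near_of_continuousOn 0 1 f f.continuous.continuousOn
    (ε / K) (by positivity)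
  have hpi : ∀ ρ : Measure ℝ, IsFiniteMeasure ρ → (∀ᵐ x ∂ρ, x ∈ Icc (0 : ℝ) 1) →
      |∫ x, f x ∂ρ - ∫ x, p.eval x ∂ρ| ≤ ε / K * ρ.real univ := by
    intro ρ _ hρ
    have hb : Integrable (fun x => p.eval x) ρ := by
      obtain ⟨C, hC⟩ := isCompact_Icc.exists_bound_of_continuousOn
        (p.continuous.continuousOn (s := Icc (0 : ℝ) 1))
      refine Integrable.of_bound (by fun_prop) C ?_
      filter_upwards [hρ] with x hx using hC x hx
    rw [← integral_sub (f.integrable ρ) hb]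
    refine norm_integral_le_of_norm_le_const (f := fun x => f x - p.eval x) ?_
    filter_upwards [hρ] with x hx
    rw [Real.norm_eq_abs, abs_sub_comm]
    exact (hp x hx).le
  have e := integral_polynomial_eq_of_moments hμ hν hm p
  have h1 := hpi μ inferInstance hμ
  have h2 := hpi ν inferInstance hν
  rw [Real.dist_eq]
  have : |∫ x, f x ∂μ - ∫ x, f x ∂ν| ≤ ε / K * μ.real univ + ε / K * ν.real univ := by
    rw [e] at h1
    rw [abs_sub_comm] at h2
    exact (abs_sub_le _ _ _).trans (add_le_add h1 h2)
  refine this.trans ?_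
  rw [← mul_add, div_mul_eq_mul_div, div_le_iff₀ hKpos]
  exact mul_le_mul_of_nonneg_left (by linarith) hε.le

/-! ### Gauss's triplication formula. -/

theorem convexOn_log_Gamma_third {c : ℝ} (hc : 0 ≤ c) :
    ConvexOn ℝ (Ioi 0) fun s => log (Gamma (s / 3 + c)) := by
  refine ⟨convex_Ioi 0, fun x hx y hy a b ha hb hab => ?_⟩
  have hx' : x / 3 + c ∈ Ioi (0 : ℝ) := by
    have : (0 : ℝ) < x := hx
    show 0 < x / 3 + c
    positivity
  have hy' : y / 3 + c ∈ Ioi (0 : ℝ) := by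
    have : (0 : ℝ) < y := hy
    show 0 < y / 3 + c
    positivity
  have := convexOn_log_Gamma.2 hx' hy' ha hb hab
  simp only [smul_eq_mul, Function.comp_apply] at this ⊢
  convert this using 3
  linear_combination (-c) * hab

theorem Gamma_one_third_mul_Gamma_two_thirds :
    Gamma (1 / 3) * Gamma (2 / 3) = 2 * √3 * π / 3 := by
  have h := Gamma_mul_Gamma_one_sub (1 / 3)
  rw [show (1 : ℝ) - 1 / 3 = 2 / 3 by norm_num, show π * (1 / 3) = π / 3 by ring,
    sin_pi_div_three] at h
  rw [h]
  have : √3 * √3 = 3 := mul_self_sqrt (by norm_num)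
  field_simp
  nlinarith

/-- Gauss's multiplication formula for three factors. -/
theorem Gamma_triplication {s : ℝ} (hs : 0 < s) :
    (3 : ℝ) ^ (3 * s) * (Gamma s * Gamma (s + 1 / 3) * Gamma (s + 2 / 3))
      = 2 * √3 * π * Gamma (3 * s) := by
  set C : ℝ := 2 * √3 * π with hC
  have hCpos : 0 < C := by positivity
  set f : ℝ → ℝ := fun t => (3 : ℝ) ^ t * (Gamma (t / 3) * Gamma (t / 3 + 1 / 3)
    * Gamma (t / 3 + 2 / 3)) / C with hf
  have hG : ∀ {t : ℝ}, 0 < t → 0 < Gamma (t / 3) ∧ 0 < Gamma (t / 3 + 1 / 3)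
      ∧ 0 < Gamma (t / 3 + 2 / 3) := fun {t} ht =>
    ⟨Gamma_pos_of_pos (by positivity), Gamma_pos_of_pos (by positivity),
      Gamma_pos_of_pos (by positivity)⟩
  have hpos : ∀ {t : ℝ}, 0 < t → 0 < f t := by
    intro t ht
    obtain ⟨h0, h1, h2⟩ := hG ht
    simp only [hf]
    positivity
  -- Bohr–Mollerup: the shift `t ↦ t + 1` permutes the three Gamma factors cyclically up to a factor
  -- `t / 3`, `log f` is a sum of convex and affine functions, and the reflection formula at `1/3`
  -- gives `f 1 = 1`.
  have key : EqOn f Gamma (Ioi 0) := by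
    refine eq_Gamma_of_log_convex ?_ ?_ hpos ?_
    · have e : EqOn (fun t => log (Gamma (t / 3 + 0)) + log (Gamma (t / 3 + 1 / 3))
          + log (Gamma (t / 3 + 2 / 3)) + t * log 3 + - log C) (log ∘ f) (Ioi 0) := by
        intro t ht
        obtain ⟨h0, h1, h2⟩ := hG ht
        simp only [hf, Function.comp_apply, add_zero]
        rw [log_div (by positivity) hCpos.ne', log_mul (rpow_pos_of_pos three_pos t).ne'
          (by positivity), log_mul (mul_pos h0 h1).ne' h2.ne', log_mul h0.ne' h1.ne',
          log_rpow three_pos]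
        ring
      refine ConvexOn.congr ?_ e
      refine ((((convexOn_log_Gamma_third le_rfl).add
        (convexOn_log_Gamma_third (by norm_num))).add
        (convexOn_log_Gamma_third (by norm_num))).add ?_).add_const _
      refine ⟨convex_Ioi 0, fun x _ y _ a b _ _ _ => ?_⟩
      simp only [smul_eq_mul]
      exact le_of_eq (by ring)
    · intro y hy
      simp only [hf]
      rw [show (y + 1) / 3 = y / 3 + 1 / 3 by ring,
        show y / 3 + 1 / 3 + 1 / 3 = y / 3 + 2 / 3 by ring,
        show y / 3 + 1 / 3 + 2 / 3 = y / 3 + 1 by ring, Gamma_add_one (by positivity),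
        rpow_add (by norm_num), rpow_one]
      ring
    · simp only [hf]
      rw [show (1 : ℝ) / 3 + 1 / 3 = 2 / 3 by norm_num, show (1 : ℝ) / 3 + 2 / 3 = 1 by norm_num,
        Gamma_one, rpow_one, Gamma_one_third_mul_Gamma_two_thirds, hC]
      field_simp
  have h := key (show 3 * s ∈ Ioi (0 : ℝ) by simpa using hs)
  simp only [hf] at h
  rw [mul_div_cancel_left₀ _ (by norm_num : (3 : ℝ) ≠ 0)] at h
  rw [← h]
  field_simp

/-! ### Beta integrals and Dirichlet's integral over the triangle. -/

theorem lintegral_comp_mul_add {a : ℝ} (ha : a ≠ 0) (b : ℝ) {f : ℝ → ℝ≥0∞}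
    (hf : Measurable f) :
    ∫⁻ x, f (a * x + b) = ENNReal.ofReal |a⁻¹| * ∫⁻ x, f x := by
  have h := lintegral_map (μ := (volume : Measure ℝ)) (f := fun x => f (x + b))
    (hf.comp (measurable_add_const b)) (measurable_const_mul a)
  rw [Real.map_volume_mul_left ha, lintegral_smul_measure,
    lintegral_add_right_eq_self] at h
  exact h.symm

theorem lintegral_rpow_mul_one_sub_rpow {α β : ℝ} (hα : 0 < α) (hβ : 0 < β) :
    ∫⁻ x in Ioo (0 : ℝ) 1, ENNReal.ofReal (x ^ (α - 1) * (1 - x) ^ (β - 1))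
      = ENNReal.ofReal (Gamma α * Gamma β / Gamma (α + β)) := by
  have h := ProbabilityTheory.lintegral_betaPDF_eq_one hα hβ
  have hp : 0 < ProbabilityTheory.beta α β := ProbabilityTheory.beta_pos hα hβ
  rw [ProbabilityTheory.lintegral_betaPDF] at h
  simp_rw [mul_assoc, ENNReal.ofReal_mul (one_div_nonneg.mpr hp.le)] at h
  rw [lintegral_const_mul' _ _ ENNReal.ofReal_ne_top] at h
  have e : ENNReal.ofReal (ProbabilityTheory.beta α β)
      * ENNReal.ofReal (1 / ProbabilityTheory.beta α β) = 1 := by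
    rw [← ENNReal.ofReal_mul hp.le, mul_one_div_cancel hp.ne', ENNReal.ofReal_one]
  generalize lintegral _ _ = I at h ⊢
  change _ = ENNReal.ofReal (ProbabilityTheory.beta α β)
  rw [← one_mul I, ← e, mul_assoc, h, mul_one]

/-- The open simplex. -/
def simplex : Set (ℝ × ℝ) := {a | 0 < a.1 ∧ 0 < a.2 ∧ a.1 + a.2 < 1}

/-- The product of the three barycentric coordinates. -/
def bary (a : ℝ × ℝ) : ℝ := a.1 * a.2 * (1 - a.1 - a.2)

theorem measurableSet_simplex : MeasurableSet simplex := by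
  refine ((measurableSet_lt measurable_const measurable_fst).inter
    ((measurableSet_lt measurable_const measurable_snd).inter
    (measurableSet_lt (measurable_fst.add measurable_snd) measurable_const)))

theorem measurable_bary : Measurable bary := by unfold bary; fun_prop

theorem bary_pos {a : ℝ × ℝ} (ha : a ∈ simplex) : 0 < bary a :=
  mul_pos (mul_pos ha.1 ha.2.1) (by linarith [ha.2.2])

theorem bary_le {a : ℝ × ℝ} (ha : a ∈ simplex) : 27 * bary a ≤ 1 := by
  obtain ⟨h1, h2, h3⟩ := ha
  unfold bary
  nlinarith [mul_nonneg h1.le (sq_nonneg (a.2 - (1 - a.1 - a.2))),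
    mul_nonneg h2.le (sq_nonneg (a.1 - (1 - a.1 - a.2))),
    mul_nonneg (by linarith : 0 ≤ 1 - a.1 - a.2) (sq_nonneg (a.1 - a.2)),
    sq_nonneg (a.2 - (1 - a.1 - a.2)), sq_nonneg (a.1 - (1 - a.1 - a.2)), sq_nonneg (a.1 - a.2)]

theorem lintegral_rpow_mul_sub_rpow {c s : ℝ} (hc : 0 < c) (hs : 0 < s) :
    ∫⁻ x, (Ioo 0 c).indicator (fun x => ENNReal.ofReal (x ^ (s - 1) * (c - x) ^ (s - 1))) x
      = ENNReal.ofReal (c ^ (2 * s - 1) * (Gamma s * Gamma s / Gamma (s + s))) := by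
  set f : ℝ → ℝ≥0∞ := (Ioo 0 c).indicator
    fun x => ENNReal.ofReal (x ^ (s - 1) * (c - x) ^ (s - 1)) with hf
  have hfm : Measurable f := Measurable.indicator (by fun_prop) measurableSet_Ioo
  have h := lintegral_comp_mul_add hc.ne' 0 hfm
  have hcc : (1 : ℝ≥0∞) = ENNReal.ofReal c * ENNReal.ofReal |c⁻¹| := by
    rw [abs_of_pos (inv_pos.mpr hc), ← ENNReal.ofReal_mul hc.le, mul_inv_cancel₀ hc.ne',
      ENNReal.ofReal_one]
  have e : ∀ x, f (c * x + 0) = (Ioo (0 : ℝ) 1).indicator (fun x =>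
      ENNReal.ofReal (c ^ (2 * s - 2)) * ENNReal.ofReal (x ^ (s - 1) * (1 - x) ^ (s - 1))) x := by
    intro x
    by_cases hx : x ∈ Ioo (0 : ℝ) 1
    · have hx' : c * x + 0 ∈ Ioo 0 c := by
        rw [add_zero]
        exact ⟨mul_pos hc hx.1, mul_lt_of_lt_one_right hc hx.2⟩
      rw [hf, indicator_of_mem hx', indicator_of_mem hx, ← ENNReal.ofReal_mul (by positivity),
        add_zero, show c - c * x = c * (1 - x) by ring, mul_rpow hc.le hx.1.le,
        mul_rpow hc.le (by linarith [hx.2]), show 2 * s - 2 = (s - 1) + (s - 1) by ring,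
        rpow_add hc]
      ring_nf
    · have hx' : c * x + 0 ∉ Ioo 0 c := by
        rw [add_zero]
        exact fun h => hx ⟨by have := h.1; by_contra hh; nlinarith,
          by have := h.2; by_contra hh; nlinarith⟩
      rw [hf, indicator_of_notMem hx', indicator_of_notMem hx]
  simp_rw [e] at h
  rw [lintegral_indicator measurableSet_Ioo, lintegral_const_mul' _ _ ENNReal.ofReal_ne_top,
    lintegral_rpow_mul_one_sub_rpow hs hs] at h
  rw [← one_mul (lintegral _ _), hcc, mul_assoc, ← h, ← ENNReal.ofReal_mul (by positivity),
    ← ENNReal.ofReal_mul hc.le, ← mul_assoc, show 2 * s - 1 = 1 + (2 * s - 2) by ring,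
    rpow_add hc, rpow_one]

/-- Dirichlet's integral over the triangle. -/
theorem lintegral_bary_rpow {s : ℝ} (hs : 0 < s) :
    ∫⁻ a in simplex, ENNReal.ofReal (bary a ^ (s - 1))
      = ENNReal.ofReal (Gamma s ^ 3 / Gamma (3 * s)) := by
  rw [← lintegral_indicator measurableSet_simplex, Measure.volume_eq_prod, lintegral_prod _
    ((Measurable.indicator (by unfold bary; fun_prop) measurableSet_simplex).aemeasurable)]
  -- On the fibre over `x` the integral is a symmetric Beta integral on an interval of length `1 -
  -- x`, which contributes `(1 - x) ^ (2s - 1)`. What is left is a Beta integral with parameters `s,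
  -- 2s`.
  have e : ∀ x, ∫⁻ y, simplex.indicator (fun a => ENNReal.ofReal (bary a ^ (s - 1))) (x, y)
      = (Ioo (0 : ℝ) 1).indicator (fun x => ENNReal.ofReal (Gamma s * Gamma s / Gamma (s + s))
        * ENNReal.ofReal (x ^ (s - 1) * (1 - x) ^ (2 * s - 1))) x := by
    intro x
    by_cases hx : x ∈ Ioo (0 : ℝ) 1
    · have hx1 : 0 < 1 - x := by linarith [hx.2]
      rw [indicator_of_mem hx]
      have : ∀ y, simplex.indicator (fun a => ENNReal.ofReal (bary a ^ (s - 1))) (x, y)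
          = ENNReal.ofReal (x ^ (s - 1)) * (Ioo 0 (1 - x)).indicator
            (fun y => ENNReal.ofReal (y ^ (s - 1) * ((1 - x) - y) ^ (s - 1))) y := by
        intro y
        by_cases hy : y ∈ Ioo 0 (1 - x)
        · have hm : (x, y) ∈ simplex := ⟨hx.1, hy.1, by simpa using by linarith [hy.2]⟩
          rw [indicator_of_mem hm, indicator_of_mem hy, ← ENNReal.ofReal_mul
            (rpow_nonneg hx.1.le _), bary, mul_rpow (mul_nonneg hx.1.le hy.1.le)
            (by linarith [hy.2]), mul_rpow hx.1.le hy.1.le, mul_assoc]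
        · have hm : (x, y) ∉ simplex := fun hm => hy ⟨hm.2.1, by
            have := hm.2.2
            simp only at this
            linarith⟩
          rw [indicator_of_notMem hm, indicator_of_notMem hy, mul_zero]
      simp_rw [this]
      rw [lintegral_const_mul' _ _ ENNReal.ofReal_ne_top, lintegral_rpow_mul_sub_rpow hx1 hs,
        ENNReal.ofReal_mul (rpow_nonneg hx1.le _), ENNReal.ofReal_mul (rpow_nonneg hx.1.le _)]
      ring
    · rw [indicator_of_notMem hx]
      refine (lintegral_congr fun y => ?_).trans lintegral_zero
      refine indicator_of_notMem (fun hm => hx ⟨hm.1, ?_⟩) _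
      have h1 := hm.2.1
      have h2 := hm.2.2
      simp only at h1 h2
      linarith
  simp_rw [e]
  have h2 := lintegral_rpow_mul_one_sub_rpow hs (show 0 < 2 * s by positivity)
  have hg1 := Gamma_pos_of_pos (show 0 < s + s by positivity)
  have hg := Gamma_pos_of_pos hs
  rw [lintegral_indicator measurableSet_Ioo, lintegral_const_mul' _ _ ENNReal.ofReal_ne_top, h2,
    ← ENNReal.ofReal_mul (by positivity), show 2 * s = s + s by ring,
    show s + (s + s) = 3 * s by ring]
  congr 1
  field_simp

/-! ### Coefficients of the two hypergeometric solutions and their decay. -/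

/-- The coefficients of the hypergeometric series `₂F₁(1/3, 2/3; 1; u)`. -/
noncomputable def coefA (n : ℕ) : ℝ :=
  poch (1 / 3) n * poch (2 / 3) n / ((n.factorial : ℝ) * (n.factorial : ℝ))

/-- The constants that accompany the logarithm in the second hypergeometric solution. -/
noncomputable def coefL (n : ℕ) : ℝ := log 27 - ∑ j ∈ Finset.Icc (n + 1) (3 * n), (3 : ℝ) / (j : ℝ)

theorem coefA_zero : coefA 0 = 1 := by simp [coefA, poch]

theorem coefA_succ (n : ℕ) :
    coefA (n + 1) * ((n : ℝ) + 1) ^ 2 = ((n : ℝ) + 1 / 3) * ((n : ℝ) + 2 / 3) * coefA n := by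
  have h : (n.factorial : ℝ) ≠ 0 := by positivity
  have h1 : (n : ℝ) + 1 ≠ 0 := by positivity
  simp only [coefA, poch, Finset.prod_range_succ, Nat.factorial_succ, Nat.cast_mul, Nat.cast_add,
    Nat.cast_one]
  field_simp
  ring

theorem coefA_pos (n : ℕ) : 0 < coefA n := by
  induction n with
  | zero => rw [coefA_zero]; exact one_pos
  | succ n ih =>
    have h := coefA_succ n
    have : 0 < coefA (n + 1) * ((n : ℝ) + 1) ^ 2 := by rw [h]; positivity
    exact pos_of_mul_pos_left this (by positivity)

/-- The induction reduces to `(n + 1/3)(n + 2/3)(n + 2) ≤ (n + 1)³`. This decay, with one more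
factor of order `1/n`, makes every series below converge even at the endpoint `1`. -/
theorem coefA_le (n : ℕ) : coefA n ≤ 1 / ((n : ℝ) + 1) := by
  induction n with
  | zero => simp [coefA_zero]
  | succ n ih =>
    have h := coefA_succ n
    have hn : (0 : ℝ) ≤ n := n.cast_nonneg
    have e : coefA (n + 1) = ((n : ℝ) + 1 / 3) * ((n : ℝ) + 2 / 3) * coefA n / ((n : ℝ) + 1) ^ 2 := by
      rw [← h]; field_simp
    rw [e]
    push_cast
    refine (div_le_div_of_nonneg_right (mul_le_mul_of_nonneg_left ih (by positivity))
      (by positivity)).trans ?_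
    rw [div_le_div_iff₀ (by positivity) (by positivity)]
    rw [mul_one_div, div_mul_eq_mul_div, div_le_iff₀ (by positivity)]
    nlinarith [mul_nonneg hn hn]

/-- As in Frobenius's method, `coefL n` is minus the derivative in `n` of `log (coefA n)`, with
`coefA` interpolated by Gamma functions; this is the differentiated form of the recurrence for
`coefA`. Here it follows by shifting the window of summation: three terms enter at the top and one
leaves at the bottom. -/
theorem coefL_succ (n : ℕ) :
    coefL (n + 1) = coefL n + 2 / ((n : ℝ) + 1) - 1 / ((n : ℝ) + 1 / 3)
      - 1 / ((n : ℝ) + 2 / 3) := by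
  have e1 : ∑ j ∈ Finset.Icc (n + 1) (3 * (n + 1)), (3 : ℝ) / (j : ℝ)
      = ∑ j ∈ Finset.Icc (n + 1) (3 * n), (3 : ℝ) / (j : ℝ) + 3 / (3 * n + 1) + 3 / (3 * n + 2)
        + 3 / (3 * n + 3) := by
    rw [show 3 * (n + 1) = 3 * n + 1 + 1 + 1 by ring, Finset.sum_Icc_succ_top (by omega),
      Finset.sum_Icc_succ_top (by omega), Finset.sum_Icc_succ_top (by omega)]
    push_cast
    ring_nf
  have e2 : ∑ j ∈ Finset.Icc (n + 1) (3 * (n + 1)), (3 : ℝ) / (j : ℝ)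
      = 3 / (n + 1) + ∑ j ∈ Finset.Icc (n + 1 + 1) (3 * (n + 1)), (3 : ℝ) / (j : ℝ) := by
    rw [show Finset.Icc (n + 1) (3 * (n + 1)) = insert (n + 1) (Finset.Icc (n + 1 + 1) (3 * (n + 1)))
      by ext; simp; omega, Finset.sum_insert (by simp)]
    push_cast
    rfl
  have e3 := e2.symm.trans e1
  have h1 : (3 : ℝ) / (3 * n + 1) = 1 / (n + 1 / 3) := by field_simp
  have h2 : (3 : ℝ) / (3 * n + 2) = 1 / (n + 2 / 3) := by field_simp
  have h3 : (3 : ℝ) / (3 * n + 3) = 1 / (n + 1) := by field_simp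
  rw [h1, h2, h3] at e3
  have h4 : (3 : ℝ) / (n + 1) = 3 * (1 / (n + 1)) := by ring
  have h5 : (2 : ℝ) / (n + 1) = 2 * (1 / (n + 1)) := by ring
  rw [h4] at e3
  rw [coefL, coefL, h5]
  linarith

theorem log_sub_log_le_sum_Ico {a b : ℕ} (ha : 0 < a) (hab : a ≤ b) :
    log b - log a ≤ ∑ j ∈ Finset.Ico a b, (1 : ℝ) / j := by
  induction b, hab using Nat.le_induction with
  | base => simp
  | succ b hb ih =>
    have hb0 : (0 : ℝ) < b := by exact_mod_cast lt_of_lt_of_le ha hb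
    rw [Finset.sum_Ico_succ_top hb]
    have := log_le_sub_one_of_pos (show (0 : ℝ) < ((b + 1 : ℕ) : ℝ) / b by positivity)
    rw [log_div (by positivity) hb0.ne'] at this
    have e : (((b + 1 : ℕ) : ℝ) / b) - 1 = 1 / b := by push_cast; field_simp; ring
    rw [e] at this
    linarith

theorem sum_Ico_succ_le_log_sub_log {a b : ℕ} (ha : 0 < a) (hab : a ≤ b) :
    ∑ j ∈ Finset.Ico (a + 1) (b + 1), (1 : ℝ) / j ≤ log b - log a := by
  induction b, hab using Nat.le_induction with
  | base => simp
  | succ b hb ih =>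
    have hb0 : (0 : ℝ) < b := by exact_mod_cast lt_of_lt_of_le ha hb
    rw [Finset.sum_Ico_succ_top (by omega)]
    have := log_le_sub_one_of_pos (show (0 : ℝ) < (b : ℝ) / ((b + 1 : ℕ) : ℝ) by positivity)
    rw [log_div hb0.ne' (by positivity)] at this
    have e : ((b : ℝ) / ((b + 1 : ℕ) : ℝ)) - 1 = - (1 / ((b + 1 : ℕ) : ℝ)) := by
      push_cast; field_simp; simp
    rw [e] at this
    linarith

theorem coefL_eq (n : ℕ) :
    coefL n = 3 * (log 3 - ∑ j ∈ Finset.Ico (n + 1) (3 * n + 1), (1 : ℝ) / j) := by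
  have h27 : log 27 = 3 * log 3 := by
    rw [show (27 : ℝ) = 3 ^ 3 by norm_num, log_pow]; norm_num
  rw [coefL, h27, mul_sub, Finset.mul_sum]
  congr 1
  refine Finset.sum_congr (by ext; simp) fun j _ => by ring

/-- The harmonic sum from `n + 1` to `3n` is at most `log 3`. Nonnegativity of every term of the
logarithmic series on `(0, 1]` is what permits termwise integration by Tonelli. -/
theorem coefL_nonneg (n : ℕ) : 0 ≤ coefL n := by
  rw [coefL_eq]
  rcases Nat.eq_zero_or_pos n with rfl | hn
  · simpa using log_nonneg (by norm_num)
  · have h := sum_Ico_succ_le_log_sub_log hn (show n ≤ 3 * n by omega)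
    have hn' : (n : ℝ) ≠ 0 := by positivity
    rw [Nat.cast_mul, Nat.cast_ofNat, log_mul (by norm_num) hn'] at h
    linarith

theorem coefL_le (n : ℕ) : coefL n ≤ 6 / ((n : ℝ) + 1) := by
  have hn : (0 : ℝ) ≤ n := n.cast_nonneg
  have h := log_sub_log_le_sum_Ico (Nat.succ_pos n) (show n + 1 ≤ 3 * n + 1 by omega)
  have h2 := log_le_sub_one_of_pos
    (show (0 : ℝ) < 3 * ((n + 1 : ℕ) : ℝ) / ((3 * n + 1 : ℕ) : ℝ) by positivity)
  rw [log_div (by positivity) (by positivity), log_mul (by norm_num) (by positivity)] at h2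
  have e : 3 * ((n + 1 : ℕ) : ℝ) / ((3 * n + 1 : ℕ) : ℝ) - 1 ≤ 2 / ((n : ℝ) + 1) := by
    push_cast
    rw [div_sub_one (by positivity), div_le_div_iff₀ (by positivity) (by positivity)]
    nlinarith
  rw [coefL_eq]
  have e6 : 6 / ((n : ℝ) + 1) = 3 * (2 / ((n : ℝ) + 1)) := by ring
  rw [e6]
  simp only [Nat.succ_eq_add_one] at h
  linarith

theorem one_div_add_le {s : ℝ} (hs : 0 < s) (n : ℕ) :
    1 / ((n : ℝ) + s) ≤ (1 + 1 / s) * (1 / ((n : ℝ) + 1)) := by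
  have hn : (0 : ℝ) ≤ n := n.cast_nonneg
  rw [mul_one_div, div_le_div_iff₀ (by positivity) (by positivity)]
  have : (1 + 1 / s) * (n + s) = n + s + n / s + 1 := by field_simp; ring
  rw [this]
  have : 0 ≤ (n : ℝ) / s := by positivity
  linarith

/-! ### Termwise integration of the logarithmic series. -/

/-- The integral of `u ^ (s - 1)` times the `n`-th term of the logarithmic series over `(0, t)`. -/
noncomputable def intTerm (s t : ℝ) (n : ℕ) : ℝ :=
  coefA n * (t ^ ((n : ℝ) + s) * ((coefL n - log t) / ((n : ℝ) + s) + 1 / ((n : ℝ) + s) ^ 2))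

theorem intTerm_nonneg {s t : ℝ} (hs : 0 < s) (ht : 0 < t) (ht1 : t ≤ 1) (n : ℕ) :
    0 ≤ intTerm s t n := by
  have h1 := coefL_nonneg n
  have h2 := log_nonpos ht.le ht1
  have h3 := coefA_pos n
  have h4 : 0 ≤ coefL n - log t := by linarith
  unfold intTerm
  positivity

theorem summable_intTerm {s t : ℝ} (hs : 0 < s) (ht : 0 < t) (ht1 : t ≤ 1) :
    Summable (intTerm s t) := by
  set K := 1 + 1 / s with hK
  have hK0 : 0 < K := by positivity
  have hl := log_nonpos ht.le ht1
  have hsum : Summable fun n : ℕ => ((6 - log t) * K + K ^ 2) * (1 / ((n : ℝ) + 1) ^ 2) := by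
    refine Summable.mul_left _ ?_
    have := (summable_nat_add_iff 1).mpr (summable_one_div_nat_pow.mpr one_lt_two)
    simpa using this
  refine Summable.of_nonneg_of_le (intTerm_nonneg hs ht ht1) (fun n => ?_) hsum
  have hn : (0 : ℝ) ≤ n := n.cast_nonneg
  have hA := coefA_le n
  have hA0 := coefA_pos n
  have hL : coefL n ≤ 6 := (coefL_le n).trans (div_le_self (by norm_num) (by linarith))
  have hL0 := coefL_nonneg n
  have h1 := one_div_add_le hs n
  have hp : t ^ ((n : ℝ) + s) ≤ 1 := rpow_le_one ht.le ht1 (by positivity)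
  have hp0 : 0 ≤ t ^ ((n : ℝ) + s) := by positivity
  set v := 1 / ((n : ℝ) + 1) with hv
  have hv0 : 0 < v := by positivity
  have hv1 : v ≤ 1 := by rw [hv, div_le_one (by positivity)]; linarith
  have hw0 : 0 < 1 / ((n : ℝ) + s) := by positivity
  unfold intTerm
  rw [div_eq_mul_one_div, ← one_div_pow, ← one_div_pow, ← hv]
  set w := 1 / ((n : ℝ) + s)
  have hx : (coefL n - log t) * w + w ^ 2 ≤ ((6 - log t) * K + K ^ 2) * v := by
    have h2 : (coefL n - log t) * w ≤ (6 - log t) * (K * v) :=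
      mul_le_mul (by linarith) h1 hw0.le (by linarith)
    have h3 : w ^ 2 ≤ (K * v) ^ 2 := pow_le_pow_left₀ hw0.le h1 2
    have h4 : (K * v) ^ 2 ≤ K ^ 2 * v := by
      rw [mul_pow]
      exact mul_le_mul_of_nonneg_left (by nlinarith) (by positivity)
    linarith
  have hx0 : 0 ≤ (coefL n - log t) * w + w ^ 2 := by
    have : 0 ≤ coefL n - log t := by linarith
    positivity
  calc coefA n * (t ^ ((n : ℝ) + s) * ((coefL n - log t) * w + w ^ 2))
      ≤ v * (1 * (((6 - log t) * K + K ^ 2) * v)) := by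
        refine mul_le_mul hA (mul_le_mul hp hx hx0 zero_le_one) (mul_nonneg hp0 hx0) hv0.le
    _ = _ := by ring

theorem lintegral_rpow_mul_log {p t L : ℝ} (hp : 0 < p) (ht : 0 < t) (ht1 : t ≤ 1) (hL : 0 ≤ L) :
    ∫⁻ u in Ioc 0 t, ENNReal.ofReal (u ^ (p - 1) * (L - log u))
      = ENNReal.ofReal (t ^ p * ((L - log t) / p + 1 / p ^ 2)) := by
  -- An antiderivative of the integrand. It is continuous up to `0` because `log u * u ^ p` tends to
  -- `0`.
  set F : ℝ → ℝ := fun u => u ^ p * ((L - log u) / p + 1 / p ^ 2) with hF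
  have hF' : F = fun u => (u ^ p * (L / p + 1 / p ^ 2)) - (log u * u ^ p) / p := by
    funext u; simp only [hF]; ring
  have hcont : ContinuousOn F (Icc 0 t) := by
    have h0 : Continuous fun u : ℝ => u ^ p * (L / p + 1 / p ^ 2) :=
      (continuous_id.rpow_const fun _ => Or.inr hp.le).mul continuous_const
    rw [hF']
    refine h0.continuousOn.sub (ContinuousOn.div_const ?_ p)
    intro u hu
    rcases eq_or_lt_of_le hu.1 with rfl | hu0
    · have := tendsto_log_mul_rpow_nhdsGT_zero hp
      rw [ContinuousWithinAt, zero_rpow hp.ne', mul_zero]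
      rw [← Ioc_insert_left hu.2, nhdsWithin_insert, tendsto_sup]
      refine ⟨?_, this.mono_left (nhdsWithin_mono _ fun x hx => hx.1)⟩
      have : log 0 * (0 : ℝ) ^ p = 0 := by simp
      rw [tendsto_pure_left]
      intro s hs
      rw [this]
      exact mem_of_mem_nhds hs
    · exact ((continuousAt_log hu0.ne').mul
        (continuousAt_rpow_const u p (Or.inl hu0.ne'))).continuousWithinAt
  have hderiv : ∀ u ∈ Ioo 0 t, HasDerivAt F (u ^ (p - 1) * (L - log u)) u := by
    intro u hu
    have h1 := hasDerivAt_rpow_const (p := p) (Or.inl hu.1.ne')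
    have h2 := ((hasDerivAt_log hu.1.ne').const_sub L).div_const p |>.add_const (1 / p ^ 2)
    have h := h1.mul h2
    refine h.congr_deriv ?_
    have e : u ^ p = u ^ (p - 1) * u := by
      rw [rpow_sub_one hu.1.ne', div_mul_cancel₀ _ hu.1.ne']
    have hu0 := hu.1.ne'
    rw [e]
    field_simp
    ring
  have hnn : ∀ u ∈ Ioo 0 t, 0 ≤ u ^ (p - 1) * (L - log u) := by
    intro u hu
    have := log_nonpos hu.1.le (hu.2.le.trans ht1)
    exact mul_nonneg (rpow_nonneg hu.1.le _) (by linarith)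
  -- A nonnegative derivative of a function continuous on the closed interval is integrable, so the
  -- singularity at `0` needs no estimate.
  have hint : IntegrableOn (fun u => u ^ (p - 1) * (L - log u)) (Ioc 0 t) :=
    intervalIntegral.integrableOn_deriv_of_nonneg hcont hderiv hnn
  have hval : ∫ u in (0 : ℝ)..t, u ^ (p - 1) * (L - log u) = F t - F 0 :=
    intervalIntegral.integral_eq_sub_of_hasDerivAt_of_le ht.le hcont hderiv
      ((intervalIntegrable_iff_integrableOn_Ioc_of_le ht.le).mpr hint)
  have hF0 : F 0 = 0 := by simp [hF, zero_rpow hp.ne']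
  rw [hF0, sub_zero, intervalIntegral.integral_of_le ht.le] at hval
  have hv : F t = t ^ p * ((L - log t) / p + 1 / p ^ 2) := rfl
  rw [← hv, ← hval, ofReal_integral_eq_lintegral_ofReal hint]
  rw [Filter.EventuallyLE, ae_restrict_iff' measurableSet_Ioc]
  refine ae_of_all _ fun u hu => ?_
  have := log_nonpos hu.1.le (hu.2.trans ht1)
  exact mul_nonneg (rpow_nonneg hu.1.le _) (by linarith)

/-- The logarithmic solution of the hypergeometric equation on the unit interval, which is
proportional to `₂F₁(1/3, 2/3; 1; 1 - u)`. -/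
noncomputable def logSeries (u : ℝ) : ℝ≥0∞ :=
  ∑' n, ENNReal.ofReal (coefA n * (u ^ n * (coefL n - log u)))

theorem measurable_logSeries : Measurable logSeries := by
  unfold logSeries
  exact Measurable.tsum fun n => by fun_prop

theorem lintegral_rpow_mul_logSeries {s t : ℝ} (hs : 0 < s) (ht : 0 < t) (ht1 : t ≤ 1) :
    ∫⁻ u in Ioc 0 t, ENNReal.ofReal (u ^ (s - 1)) * logSeries u
      = ENNReal.ofReal (∑' n, intTerm s t n) := by
  have h : ∀ u ∈ Ioc 0 t, ENNReal.ofReal (u ^ (s - 1)) * logSeries u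
      = ∑' n : ℕ, ENNReal.ofReal (coefA n)
        * ENNReal.ofReal (u ^ ((n : ℝ) + s - 1) * (coefL n - log u)) := by
    intro u hu
    rw [logSeries, ← ENNReal.tsum_mul_left]
    refine tsum_congr fun n => ?_
    rw [← ENNReal.ofReal_mul (rpow_nonneg hu.1.le _), ← ENNReal.ofReal_mul (coefA_pos n).le,
      show (n : ℝ) + s - 1 = n + (s - 1) by ring, rpow_add hu.1, rpow_natCast]
    ring_nf
  rw [setLIntegral_congr_fun measurableSet_Ioc h, lintegral_tsum fun n => by fun_prop,
    ENNReal.ofReal_tsum_of_nonneg (intTerm_nonneg hs ht ht1) (summable_intTerm hs ht ht1)]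
  refine tsum_congr fun n => ?_
  rw [lintegral_const_mul' _ _ ENNReal.ofReal_ne_top,
    lintegral_rpow_mul_log (by positivity) ht ht1 (coefL_nonneg n),
    ← ENNReal.ofReal_mul (coefA_pos n).le]
  rfl

/-! ### Moments of the logarithmic series by telescoping. -/

theorem intTerm_one (s : ℝ) (n : ℕ) :
    intTerm s 1 n = coefA n * (coefL n / ((n : ℝ) + s) + 1 / ((n : ℝ) + s) ^ 2) := by
  simp [intTerm]

theorem mul_coefA_mul_coefL_le (n : ℕ) : (n : ℝ) * coefA n * coefL n ≤ 6 / ((n : ℝ) + 1) := by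
  have hA := coefA_le n
  have hA0 := coefA_pos n
  have hL := coefL_le n
  have hn : (0 : ℝ) ≤ n := n.cast_nonneg
  have h1 : (n : ℝ) * coefA n ≤ 1 := by
    refine (mul_le_mul_of_nonneg_left hA hn).trans ?_
    rw [mul_one_div, div_le_one (by positivity)]
    linarith
  calc (n : ℝ) * coefA n * coefL n ≤ 1 * coefL n :=
        mul_le_mul_of_nonneg_right h1 (coefL_nonneg n)
    _ ≤ _ := by rwa [one_mul]

theorem tendsto_const_div_nat_add_one (C : ℝ) :
    Tendsto (fun n : ℕ => C / ((n : ℝ) + 1)) atTop (𝓝 0) := by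
  have := (tendsto_one_div_add_atTop_nhds_zero_nat (𝕜 := ℝ)).const_mul C
  simpa [div_eq_mul_inv] using this

theorem tendsto_coefA : Tendsto coefA atTop (𝓝 0) :=
  squeeze_zero (fun n => (coefA_pos n).le) coefA_le (tendsto_const_div_nat_add_one 1)

theorem tendsto_mul_coefA_mul_coefL :
    Tendsto (fun n : ℕ => (n : ℝ) * coefA n * coefL n) atTop (𝓝 0) :=
  squeeze_zero (fun n => mul_nonneg (mul_nonneg n.cast_nonneg (coefA_pos n).le) (coefL_nonneg n))
    mul_coefA_mul_coefL_le (tendsto_const_div_nat_add_one 6)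

/-- The sum telescopes. With `coefA` interpolated in `n`, the summand is minus the derivative of
`coefA n / (n + 1)`, and `D` is minus the derivative of `n * coefA n`, whose difference is `2/9`
times `coefA n / (n + 1)`. Only `D 0 = -1` survives. -/
theorem tsum_intTerm_one_one : ∑' n, intTerm 1 1 n = 9 / 2 := by
  set D : ℕ → ℝ := fun n => n * coefA n * coefL n - coefA n with hD
  have hstep : ∀ n : ℕ, 2 / 9 * intTerm 1 1 n = D (n + 1) - D n := by
    intro n
    have hA : coefA (n + 1)
        = ((n : ℝ) + 1 / 3) * ((n : ℝ) + 2 / 3) * coefA n / ((n : ℝ) + 1) ^ 2 := by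
      rw [← coefA_succ]; field_simp
    simp only [hD, intTerm_one]
    rw [coefL_succ, hA]
    push_cast
    field_simp
    ring
  have hs := (summable_intTerm one_pos one_pos le_rfl).hasSum.mul_left (2 / 9)
  have h1 := hs.tendsto_sum_nat
  have h2 : Tendsto D atTop (𝓝 0) := by
    simpa using tendsto_mul_coefA_mul_coefL.sub tendsto_coefA
  have h3 : Tendsto (fun N => D N - D 0) atTop (𝓝 (0 - D 0)) := h2.sub_const _
  have e : (fun N => ∑ i ∈ Finset.range N, 2 / 9 * intTerm 1 1 i) = fun N => D N - D 0 := by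
    funext N
    rw [← Finset.sum_range_sub]
    exact Finset.sum_congr rfl fun i _ => hstep i
  rw [e] at h1
  have := tendsto_nhds_unique h1 h3
  have hD0 : D 0 = -1 := by simp [hD, coefA_zero]
  rw [hD0] at this
  linarith

/-- The same telescoping with `D` minus the derivative in `n` of `n² * coefA n / (n + s)`; division
with remainder of the difference of the latter leaves exactly the two poles at `-s - 1` and `-s`.
Both boundary terms of `D` vanish. This is the moment recurrence that `27ˢ Γ(s)³ / Γ(3s)` also
satisfies. -/
theorem tsum_intTerm_add_one {s : ℝ} (hs : 0 < s) :
    (s + 1 / 3) * (s + 2 / 3) * ∑' n, intTerm (s + 1) 1 n = s ^ 2 * ∑' n, intTerm s 1 n := by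
  set D : ℕ → ℝ := fun n => n / (n + s) * (n * coefA n * coefL n) + (n / (n + s)) ^ 2 * coefA n
    - 2 * (n / (n + s)) * coefA n with hD
  have hstep : ∀ n : ℕ, (s + 1 / 3) * (s + 2 / 3) * intTerm (s + 1) 1 n - s ^ 2 * intTerm s 1 n
      = D (n + 1) - D n := by
    intro n
    have hA : coefA (n + 1)
        = ((n : ℝ) + 1 / 3) * ((n : ℝ) + 2 / 3) * coefA n / ((n : ℝ) + 1) ^ 2 := by
      rw [← coefA_succ]; field_simp
    have e1 : ((n : ℝ) + 1) + s = n + (s + 1) := by ring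
    have h1 : (n : ℝ) + s ≠ 0 := by positivity
    have h2 : (n : ℝ) + (s + 1) ≠ 0 := by positivity
    simp only [hD, intTerm_one]
    rw [coefL_succ, hA]
    push_cast
    rw [e1]
    field_simp
    ring
  have hsum := ((summable_intTerm (by positivity : 0 < s + 1) one_pos le_rfl).hasSum.mul_left
    ((s + 1 / 3) * (s + 2 / 3))).sub ((summable_intTerm hs one_pos le_rfl).hasSum.mul_left (s ^ 2))
  have h1 := hsum.tendsto_sum_nat
  have hb : ∀ n : ℕ, 0 ≤ (n : ℝ) / (n + s) ∧ (n : ℝ) / (n + s) ≤ 1 := fun n =>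
    ⟨by positivity, (div_le_one (by positivity)).mpr (by linarith)⟩
  have h2 : Tendsto D atTop (𝓝 0) := by
    have t1 : Tendsto (fun n : ℕ => (n : ℝ) / (n + s) * (n * coefA n * coefL n)) atTop (𝓝 0) :=
      squeeze_zero (fun n => mul_nonneg (hb n).1
        (mul_nonneg (mul_nonneg n.cast_nonneg (coefA_pos n).le) (coefL_nonneg n)))
        (fun n => mul_le_of_le_one_left
          (mul_nonneg (mul_nonneg n.cast_nonneg (coefA_pos n).le) (coefL_nonneg n)) (hb n).2)
        tendsto_mul_coefA_mul_coefL
    have t2 : Tendsto (fun n : ℕ => ((n : ℝ) / (n + s)) ^ 2 * coefA n) atTop (𝓝 0) :=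
      squeeze_zero (fun n => mul_nonneg (sq_nonneg _) (coefA_pos n).le)
        (fun n => mul_le_of_le_one_left (coefA_pos n).le (pow_le_one₀ (hb n).1 (hb n).2))
        tendsto_coefA
    have t3 : Tendsto (fun n : ℕ => 2 * ((n : ℝ) / (n + s)) * coefA n) atTop (𝓝 0) := by
      refine squeeze_zero (g := fun n => 2 * coefA n)
        (fun n => mul_nonneg (mul_nonneg two_pos.le (hb n).1) (coefA_pos n).le)
        (fun n => mul_le_mul_of_nonneg_right (by linarith [(hb n).2]) (coefA_pos n).le) ?_
      simpa using tendsto_coefA.const_mul 2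
    simpa using (t1.add t2).sub t3
  have e : (fun N => ∑ i ∈ Finset.range N, ((s + 1 / 3) * (s + 2 / 3) * intTerm (s + 1) 1 i
      - s ^ 2 * intTerm s 1 i)) = fun N => D N - D 0 := by
    funext N
    rw [← Finset.sum_range_sub]
    exact Finset.sum_congr rfl fun i _ => hstep i
  rw [e] at h1
  have := tendsto_nhds_unique h1 (h2.sub_const _)
  have hD0 : D 0 = 0 := by simp [hD]
  rw [hD0] at this
  linarith

theorem tsum_intTerm_nat (n : ℕ) :
    ∑' i, intTerm ((n : ℝ) + 1) 1 i
      = 9 * 27 ^ n * (Gamma ((n : ℝ) + 1) ^ 3 / Gamma (3 * ((n : ℝ) + 1))) := by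
  induction n with
  | zero =>
    rw [Nat.cast_zero, zero_add, tsum_intTerm_one_one, Gamma_one, mul_one,
      Gamma_ofNat_eq_factorial]
    norm_num [Nat.factorial]
  | succ n ih =>
    have h := tsum_intTerm_add_one (s := (n : ℝ) + 1) (by positivity)
    rw [ih] at h
    have hg : Gamma (3 * ((n : ℝ) + 1 + 1)) = (3 * n + 5) * (3 * n + 4) * (3 * n + 3)
        * Gamma (3 * ((n : ℝ) + 1)) := by
      rw [show 3 * ((n : ℝ) + 1 + 1) = 3 * (n + 1) + 1 + 1 + 1 by ring,
        Gamma_add_one (by positivity), Gamma_add_one (by positivity), Gamma_add_one (by positivity)]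
      ring
    have hg0 := (Gamma_pos_of_pos (show 0 < 3 * ((n : ℝ) + 1) by positivity)).ne'
    push_cast
    rw [hg, Gamma_add_one (show (n : ℝ) + 1 ≠ 0 by positivity)]
    generalize (∑' i, intTerm ((n : ℝ) + 1 + 1) 1 i) = T at h ⊢
    have h5 : T = ((n : ℝ) + 1) ^ 2 * (9 * 27 ^ n * (Gamma ((n : ℝ) + 1) ^ 3
        / Gamma (3 * ((n : ℝ) + 1)))) / (((n : ℝ) + 1 + 1 / 3) * (n + 1 + 2 / 3)) := by
      rw [← h]; field_simp
    rw [h5]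
    field_simp
    ring

/-! ### The law of the product of barycentric coordinates. -/

theorem lintegral_pow_bary (n : ℕ) :
    ∫⁻ a in simplex, ENNReal.ofReal ((27 * bary a) ^ n)
      = ENNReal.ofReal (27 ^ n * (Gamma ((n : ℝ) + 1) ^ 3 / Gamma (3 * ((n : ℝ) + 1)))) := by
  rw [ENNReal.ofReal_mul (by positivity), ← lintegral_bary_rpow (by positivity),
    ← lintegral_const_mul' _ _ ENNReal.ofReal_ne_top]
  refine lintegral_congr fun a => ?_
  rw [← ENNReal.ofReal_mul (by positivity), add_sub_cancel_right, rpow_natCast, mul_pow]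

/-- The product of the barycentric coordinates of a uniformly distributed point of the simplex has
the density given by the logarithmic hypergeometric series. -/
theorem map_bary :
    (volume.restrict simplex).map (fun a => 27 * bary a)
      = ENNReal.ofReal (1 / 9) • (volume.restrict (Ioc (0 : ℝ) 1)).withDensity logSeries := by
  have hm : Measurable fun a => 27 * bary a := measurable_bary.const_mul 27
  have h0 := lintegral_pow_bary 0
  have h1 := lintegral_rpow_mul_logSeries one_pos one_pos le_rfl
  simp only [pow_zero, ENNReal.ofReal_one, sub_self, rpow_zero, one_mul, lintegral_const] at h0 h1
  have : IsFiniteMeasure (volume.restrict simplex) := ⟨by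
    rw [h0]; exact ENNReal.ofReal_lt_top⟩
  have : IsFiniteMeasure ((volume.restrict (Ioc (0 : ℝ) 1)).withDensity logSeries) :=
    isFiniteMeasure_withDensity (by rw [h1]; exact ENNReal.ofReal_ne_top)
  have : IsFiniteMeasure (ENNReal.ofReal (1 / 9) •
      (volume.restrict (Ioc (0 : ℝ) 1)).withDensity logSeries) :=
    Measure.smul_finite _ ENNReal.ofReal_ne_top
  refine ext_of_moments ?_ ?_ fun n => ?_
  · rw [ae_map_iff hm.aemeasurable (p := (· ∈ Icc (0 : ℝ) 1)) measurableSet_Icc,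
      ae_restrict_iff' measurableSet_simplex]
    exact ae_of_all _ fun a ha => ⟨by linarith [bary_pos ha], bary_le ha⟩
  · refine Measure.ae_smul_measure ?_ _
    refine (withDensity_absolutelyContinuous _ _).ae_le ?_
    filter_upwards [ae_restrict_mem measurableSet_Ioc] with x hx using ⟨hx.1.le, hx.2⟩
  · have h2 := lintegral_rpow_mul_logSeries (show 0 < (n : ℝ) + 1 by positivity) one_pos le_rfl
    rw [lintegral_map (by fun_prop) hm, lintegral_pow_bary, lintegral_smul_measure,
      lintegral_withDensity_eq_lintegral_mul _ measurable_logSeries (by fun_prop)]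
    simp only [add_sub_cancel_right, rpow_natCast, tsum_intTerm_nat] at h2
    simp only [Pi.mul_apply, mul_comm (logSeries _)]
    rw [h2, smul_eq_mul, ← ENNReal.ofReal_mul (by norm_num)]
    ring_nf

theorem lintegral_comp_bary {g : ℝ → ℝ≥0∞} (hg : Measurable g) :
    ∫⁻ a in simplex, g (27 * bary a)
      = ENNReal.ofReal (1 / 9) * ∫⁻ u in Ioc (0 : ℝ) 1, g u * logSeries u := by
  rw [← lintegral_map hg (measurable_bary.const_mul 27), map_bary, lintegral_smul_measure,
    lintegral_withDensity_eq_lintegral_mul _ measurable_logSeries hg]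
  simp only [Pi.mul_apply, mul_comm (logSeries _), smul_eq_mul]

/-- Telescoping determines the moments only at positive integers. Once the two measures agree,
Dirichlet's integral gives the moment at every real `s > 0`, in particular at `s = 1/2`. -/
theorem tsum_intTerm {s : ℝ} (hs : 0 < s) :
    ∑' i, intTerm s 1 i = 9 * 27 ^ (s - 1) * (Gamma s ^ 3 / Gamma (3 * s)) := by
  have hg := Gamma_pos_of_pos hs
  have hg3 := Gamma_pos_of_pos (show 0 < 3 * s by positivity)
  have h := lintegral_comp_bary (g := fun u => ENNReal.ofReal (u ^ (s - 1))) (by fun_prop)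
  rw [lintegral_rpow_mul_logSeries hs one_pos le_rfl, ← ENNReal.ofReal_mul (by norm_num)] at h
  have e : ∀ a ∈ simplex, ENNReal.ofReal ((27 * bary a) ^ (s - 1))
      = ENNReal.ofReal (27 ^ (s - 1)) * ENNReal.ofReal (bary a ^ (s - 1)) := fun a ha => by
    rw [mul_rpow (by norm_num) (bary_pos ha).le, ENNReal.ofReal_mul (by positivity)]
  rw [setLIntegral_congr_fun measurableSet_simplex e,
    lintegral_const_mul' _ _ ENNReal.ofReal_ne_top, lintegral_bary_rpow hs,
    ← ENNReal.ofReal_mul (by positivity), ENNReal.ofReal_eq_ofReal_iff (by positivity)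
    (mul_nonneg (by norm_num) (tsum_nonneg (intTerm_nonneg hs one_pos le_rfl)))] at h
  linarith

theorem tsum_intTerm_half : ∑' i, intTerm (1 / 2) 1 i = 2 * √3 * π := by
  have h27 : (27 : ℝ) ^ ((1 : ℝ) / 2 - 1) = 1 / (3 * √3) := by
    rw [show (1 : ℝ) / 2 - 1 = -(1 / 2) by norm_num, rpow_neg (by norm_num), ← sqrt_eq_rpow,
      show (27 : ℝ) = 3 ^ 2 * 3 by norm_num, sqrt_mul (by norm_num), sqrt_sq (by norm_num), one_div]
  have h3 : Gamma (3 * (1 / 2)) = 1 / 2 * √π := by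
    rw [show (3 : ℝ) * (1 / 2) = 1 / 2 + 1 by norm_num, Gamma_add_one (by norm_num),
      Gamma_one_half_eq]
  rw [tsum_intTerm (by norm_num), h27, h3, Gamma_one_half_eq]
  have hp : √π ^ 2 = π := sq_sqrt pi_pos.le
  have hs : √3 ^ 2 = 3 := sq_sqrt (by norm_num)
  field_simp
  nlinarith

/-! ### Integration over `Ω`. -/

theorem lintegral_comp_sq_add_sq {f : ℝ → ℝ≥0∞} (hf : Measurable f) :
    ∫⁻ p : ℝ × ℝ, f (p.1 ^ 2 + p.2 ^ 2) = ENNReal.ofReal π * ∫⁻ r in Ioi (0 : ℝ), f r := by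
  rw [← lintegral_comp_polarCoord_symm]
  have e : ∀ p : ℝ × ℝ, ENNReal.ofReal p.1 • f ((polarCoord.symm p).1 ^ 2 + (polarCoord.symm p).2 ^ 2)
      = ENNReal.ofReal p.1 * f (p.1 ^ 2) := by
    intro p
    simp only [polarCoord_symm_apply, smul_eq_mul, mul_pow, ← mul_add, cos_sq_add_sin_sq, mul_one]
  simp_rw [e]
  rw [polarCoord_target, Measure.volume_eq_prod, ← Measure.prod_restrict, lintegral_prod _
    (by fun_prop)]
  simp only [lintegral_const, Measure.restrict_apply MeasurableSet.univ, univ_inter, volume_Ioo]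
  have h := lintegral_image_eq_lintegral_abs_deriv_mul (s := Ioi (0 : ℝ)) (f := fun r => r ^ 2)
    (f' := fun r => 2 * r) measurableSet_Ioi
    (fun x _ => by simpa using (hasDerivAt_pow 2 x).hasDerivWithinAt)
    (fun x hx y hy hxy => by
      exact (pow_left_inj₀ (le_of_lt hx) (le_of_lt hy) two_ne_zero).mp hxy) f
  have himg : (fun r : ℝ => r ^ 2) '' Ioi 0 = Ioi 0 := by
    ext y
    constructor
    · rintro ⟨x, hx, rfl⟩
      exact pow_pos (show (0 : ℝ) < x from hx) 2
    · intro hy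
      exact ⟨√y, sqrt_pos.mpr hy, sq_sqrt (le_of_lt hy)⟩
  rw [himg] at h
  rw [h, lintegral_mul_const' _ _ ENNReal.ofReal_ne_top, mul_comm,
    show π - -π = π * 2 by ring, ENNReal.ofReal_mul pi_pos.le, mul_assoc,
    ← lintegral_const_mul' _ _ ENNReal.ofReal_ne_top]
  congr 1
  refine setLIntegral_congr_fun measurableSet_Ioi fun x hx => ?_
  have hx0 : (0 : ℝ) < x := hx
  rw [abs_of_pos (by positivity), ENNReal.ofReal_mul two_pos.le, mul_assoc]

theorem lintegral_fin_succ {n : ℕ} {f : (Fin (n + 1) → ℝ) → ℝ≥0∞} (hf : Measurable f) :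
    ∫⁻ b, f b = ∫⁻ x, ∫⁻ c, f (Matrix.vecCons x c) := by
  have h := (volume_preserving_piFinSuccAbove (fun _ : Fin (n + 1) => ℝ) 0).symm
  rw [← h.lintegral_comp hf, Measure.volume_eq_prod, lintegral_prod
    (fun a => f ((MeasurableEquiv.piFinSuccAbove (fun _ => ℝ) 0).symm a))
    (hf.comp (MeasurableEquiv.measurable _)).aemeasurable]
  refine lintegral_congr fun x => lintegral_congr fun c => ?_
  congr 1
  ext i
  refine Fin.cases ?_ (fun j => ?_) i
  · simp [MeasurableEquiv.piFinSuccAbove]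
  · simp [MeasurableEquiv.piFinSuccAbove]

theorem lintegral_fin_four {f : (Fin 4 → ℝ) → ℝ≥0∞} (hf : Measurable f) :
    ∫⁻ b, f b = ∫⁻ x, ∫⁻ y, ∫⁻ p, ∫⁻ q, f ![x, y, p, q] := by
  have hc : ∀ {n : ℕ} (x : ℝ), Measurable fun c : Fin n → ℝ => (Matrix.vecCons x c : Fin (n + 1) → ℝ) := by
    intro n x
    refine measurable_pi_lambda _ fun i => ?_
    refine Fin.cases ?_ (fun j => ?_) i
    · simp
    · simpa using measurable_pi_apply j
  rw [lintegral_fin_succ hf]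
  refine lintegral_congr fun x => ?_
  rw [lintegral_fin_succ (f := fun c => f (Matrix.vecCons x c)) (hf.comp (hc x))]
  refine lintegral_congr fun y => ?_
  rw [lintegral_fin_succ (f := fun c => f (Matrix.vecCons x (Matrix.vecCons y c)))
    ((hf.comp (hc x)).comp (hc y))]
  refine lintegral_congr fun p => ?_
  rw [lintegral_fin_succ
    (f := fun c => f (Matrix.vecCons x (Matrix.vecCons y (Matrix.vecCons p c))))
    (((hf.comp (hc x)).comp (hc y)).comp (hc p))]
  refine lintegral_congr fun q => ?_
  rw [lintegral_unique]
  have : (volume : Measure (Fin 0 → ℝ)) univ = 1 := by simp [volume_pi]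
  rw [this, mul_one]
  congr 4

theorem Q_vec (x y p q : ℝ) :
    Q ![x, y, p, q] = 4 * x * y * p * q - (x + y + p + q - 1 - x * q - y * p) ^ 2 := by
  simp [Q]

theorem continuous_Q : Continuous Q := by unfold Q; fun_prop

theorem measurableSet_Omega : MeasurableSet Omega := by
  refine IsClosed.measurableSet ?_
  refine (isClosed_le continuous_const (continuous_apply 0)).inter
    ((isClosed_le continuous_const (continuous_apply 1)).inter
    ((isClosed_le ((continuous_apply 0).add (continuous_apply 1)) continuous_const).inter
    (isClosed_le continuous_const continuous_Q)))

/-- For a fixed first row the polynomial `Q` is an inverted paraboloid in the second row. -/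
theorem lintegral_Q_row {x y : ℝ} (h : (x, y) ∈ simplex) {g : ℝ → ℝ≥0∞} (hg : Measurable g) :
    ∫⁻ p, ∫⁻ q, g (Q ![x, y, p, q])
      = ENNReal.ofReal (π * √(bary (x, y)) / 2)
        * ∫⁻ r in Ioi (0 : ℝ), g (bary (x, y) * (1 - r)) := by
  have hM := bary_pos h
  set m := bary (x, y) with hm
  have hx : 0 < 1 - x := by
    have h2 := h.2.1
    have h3 := h.2.2
    simp only at h2 h3
    linarith
  set s := √m with hs
  have hs0 : 0 < s := sqrt_pos.mpr hM
  have hss : s ^ 2 = m := sq_sqrt hM.le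
  set G : ℝ → ℝ → ℝ≥0∞ := fun X Y => g (m * (1 - (X ^ 2 + Y ^ 2))) with hG
  have hGm : Measurable (Function.uncurry G) := by
    exact hg.comp (f := fun z : ℝ × ℝ => m * (1 - (z.1 ^ 2 + z.2 ^ 2))) (by fun_prop)
  have hGm1 : ∀ X, Measurable (G X) := fun X =>
    hg.comp (f := fun Y => m * (1 - (X ^ 2 + Y ^ 2))) (by fun_prop)
  -- Completing the square in `q`, where the leading coefficient is `-(1 - x)²`, leaves a quadratic
  -- in `p` with roots `0` and `1 - x` and maximum `m`. The two scalings have Jacobian `s / (1 - x)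
  -- * ((1 - x) / 2) = s / 2`.
  have hQ : ∀ p q, g (Q ![x, y, p, q]) = G (2 / (1 - x) * p + -1)
      ((1 - x) / s * q + (((1 - y) * p - (1 - x - y) - 2 * x * y * p / (1 - x)) / s)) := by
    intro p q
    simp only [hG]
    congr 1
    rw [Q_vec]
    have e : m * (1 - ((2 / (1 - x) * p + -1) ^ 2 + ((1 - x) / s * q
        + (((1 - y) * p - (1 - x - y) - 2 * x * y * p / (1 - x)) / s)) ^ 2))
        = m * (1 - (2 / (1 - x) * p + -1) ^ 2) - ((1 - x) * q
        + ((1 - y) * p - (1 - x - y) - 2 * x * y * p / (1 - x))) ^ 2 := by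
      rw [← hss]
      field_simp
      ring
    rw [e, hm, bary]
    simp only
    field_simp
    ring
  have h1 : ∀ p, ∫⁻ q, g (Q ![x, y, p, q])
      = ENNReal.ofReal (s / (1 - x)) * ∫⁻ Y, G (2 / (1 - x) * p + -1) Y := by
    intro p
    simp_rw [hQ p]
    rw [lintegral_comp_mul_add (by positivity) _ (f := G (2 / (1 - x) * p + -1))
      (hGm1 _), abs_of_pos (by positivity), inv_div]
  simp_rw [h1]
  rw [lintegral_const_mul' _ _ ENNReal.ofReal_ne_top, lintegral_comp_mul_add (by positivity) (-1)
    (f := fun X => ∫⁻ Y, G X Y) hGm.lintegral_prod_right, abs_of_pos (by positivity), inv_div,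
    ← mul_assoc, ← ENNReal.ofReal_mul (by positivity)]
  have h3 : ∫⁻ X, ∫⁻ Y, G X Y = ∫⁻ p : ℝ × ℝ, g (m * (1 - (p.1 ^ 2 + p.2 ^ 2))) := by
    rw [Measure.volume_eq_prod]
    exact (lintegral_prod _ hGm.aemeasurable).symm
  have h2 := lintegral_comp_sq_add_sq (f := fun r => g (m * (1 - r)))
    (hg.comp (f := fun r => m * (1 - r)) (by fun_prop))
  rw [h3, h2, ← mul_assoc, ← ENNReal.ofReal_mul (by positivity)]
  congr 2
  field_simp

/-- Integration over `Ω` of a function of `Q`. -/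
theorem lintegral_Omega {f : ℝ → ℝ≥0∞} (hf : Measurable f) :
    ∫⁻ b in Omega, f (Q b) = ∫⁻ a in simplex, ENNReal.ofReal (π * √(bary a) / 2)
      * ∫⁻ t in Ioc (0 : ℝ) 1, f (bary a * t) := by
  -- Truncation to `q ≥ 0` encodes the constraint `0 ≤ Q b`, so the second row may range over the
  -- whole plane.
  set g : ℝ → ℝ≥0∞ := (Ici (0 : ℝ)).indicator f with hg
  have hgm : Measurable g := hf.indicator measurableSet_Ici
  set H : ℝ × ℝ → ℝ≥0∞ := simplex.indicator fun a => ENNReal.ofReal (π * √(bary a) / 2)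
      * ∫⁻ t in Ioc (0 : ℝ) 1, f (bary a * t) with hH
  have hHm : Measurable H := by
    refine Measurable.indicator ?_ measurableSet_simplex
    refine Measurable.mul ?_ ?_
    · exact ENNReal.measurable_ofReal.comp
        (((measurable_bary.sqrt).const_mul π).div_const 2)
    · exact Measurable.lintegral_prod_right' (f := fun z : (ℝ × ℝ) × ℝ => f (bary z.1 * z.2))
        (hf.comp ((measurable_bary.comp measurable_fst).mul measurable_snd))
  rw [← lintegral_indicator measurableSet_Omega, ← lintegral_indicator measurableSet_simplex,
    Measure.volume_eq_prod, lintegral_prod _ hHm.aemeasurable,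
    lintegral_fin_four (f := Omega.indicator fun b => f (Q b))
      ((hf.comp continuous_Q.measurable).indicator measurableSet_Omega)]
  -- The triangle is open while the first-row constraints of `Ω` are closed; the boundary lines are
  -- discarded as null sets.
  have hne : ∀ c : ℝ, ∀ᵐ x : ℝ, x ≠ c := fun c => by
    simp [ae_iff]
  refine lintegral_congr_ae ?_
  filter_upwards [hne 0] with x hx0
  refine lintegral_congr_ae ?_
  filter_upwards [hne 0, hne (1 - x)] with y hy0 hy1
  by_cases hxy : (x, y) ∈ simplex
  · have hx := hxy.1
    have hy := hxy.2.1
    have hs := hxy.2.2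
    simp only at hx hy hs
    have e : ∀ p q, Omega.indicator (fun b => f (Q b)) ![x, y, p, q] = g (Q ![x, y, p, q]) := by
      intro p q
      by_cases hq : 0 ≤ Q ![x, y, p, q]
      · rw [indicator_of_mem (show ![x, y, p, q] ∈ Omega from ⟨hx.le, hy.le, hs.le, hq⟩), hg,
          indicator_of_mem (show Q ![x, y, p, q] ∈ Ici (0 : ℝ) from hq)]
      · rw [indicator_of_notMem (fun hb => hq hb.2.2.2), hg,
          indicator_of_notMem (show Q ![x, y, p, q] ∉ Ici (0 : ℝ) from hq)]
    have hM := bary_pos hxy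
    simp_rw [e]
    rw [lintegral_Q_row hxy hgm, hH, indicator_of_mem hxy]
    congr 1
    set m := bary (x, y)
    -- Substitution `t = 1 - r`, where `r` is the squared radius in the section.
    have h1 := lintegral_comp_mul_add (a := -1) (by norm_num) 1
      (f := (Iio (1 : ℝ)).indicator fun t => g (m * t))
      ((hgm.comp (measurable_const_mul m)).indicator measurableSet_Iio)
    have e1 : ∀ r, (Iio (1 : ℝ)).indicator (fun t => g (m * t)) (-1 * r + 1)
        = (Ioi (0 : ℝ)).indicator (fun r => g (m * (1 - r))) r := by
      intro r
      by_cases hr : r ∈ Ioi (0 : ℝ)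
      · have hr' : -1 * r + 1 ∈ Iio (1 : ℝ) := by
          have : 0 < r := hr
          show -1 * r + 1 < 1
          linarith
        rw [indicator_of_mem hr, indicator_of_mem hr']
        congr 2
        ring
      · have hr' : -1 * r + 1 ∉ Iio (1 : ℝ) := fun h => hr (by
          have : -1 * r + 1 < 1 := h
          show 0 < r
          linarith)
        rw [indicator_of_notMem hr, indicator_of_notMem hr']
    simp_rw [e1] at h1
    rw [lintegral_indicator measurableSet_Ioi, inv_neg, inv_one, abs_neg, abs_one,
      ENNReal.ofReal_one, one_mul] at h1
    rw [h1, ← lintegral_indicator measurableSet_Ioc]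
    refine lintegral_congr_ae ?_
    filter_upwards [hne 0, hne 1] with t ht0 ht1
    by_cases ht : t ∈ Ioc (0 : ℝ) 1
    · rw [indicator_of_mem ht, indicator_of_mem (show t ∈ Iio (1 : ℝ) from
        lt_of_le_of_ne ht.2 ht1), hg, indicator_of_mem]
      exact mul_nonneg hM.le ht.1.le
    · rw [indicator_of_notMem ht]
      by_cases ht' : t ∈ Iio (1 : ℝ)
      · rw [indicator_of_mem ht', hg, indicator_of_notMem]
        intro hmt
        have h0 : 0 ≤ t := nonneg_of_mul_nonneg_right (show 0 ≤ m * t from hmt) hM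
        exact ht ⟨lt_of_le_of_ne h0 (Ne.symm ht0), le_of_lt ht'⟩
      · rw [indicator_of_notMem ht']
  · rw [hH, indicator_of_notMem hxy]
    have e : ∀ p q, Omega.indicator (fun b => f (Q b)) ![x, y, p, q] = 0 := by
      intro p q
      refine indicator_of_notMem (fun hb => hxy ?_) _
      obtain ⟨h0, h1, h2, _⟩ := hb
      simp only [Matrix.cons_val] at h0 h1 h2
      exact ⟨lt_of_le_of_ne h0 (Ne.symm hx0), lt_of_le_of_ne h1 (Ne.symm hy0),
        lt_of_le_of_ne h2 fun h => hy1 (by linarith)⟩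
    simp_rw [e]
    simp

/-! ### Normalisation of `μ_k` and the distribution function. -/

theorem lintegral_Ioc_rpow {p t : ℝ} (hp : 0 < p) (ht : 0 < t) :
    ∫⁻ u in Ioc 0 t, ENNReal.ofReal (u ^ (p - 1)) = ENNReal.ofReal (t ^ p / p) := by
  have hi : IntervalIntegrable (fun u : ℝ => u ^ (p - 1)) volume 0 t :=
    intervalIntegral.intervalIntegrable_rpow' (by linarith)
  have h := integral_rpow (a := 0) (b := t) (r := p - 1) (Or.inl (by linarith))
  rw [sub_add_cancel, zero_rpow hp.ne', sub_zero, intervalIntegral.integral_of_le ht.le] at h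
  rw [← h, ofReal_integral_eq_lintegral_ofReal
    ((intervalIntegrable_iff_integrableOn_Ioc_of_le ht.le).mp hi)]
  rw [Filter.EventuallyLE, ae_restrict_iff' measurableSet_Ioc]
  exact ae_of_all _ fun u hu => rpow_nonneg hu.1.le _

/-- The normalising constant `h_k`. -/
noncomputable def normConst (k : ℝ) : ℝ := π / (2 * k - 1) * (Gamma k ^ 3 / Gamma (3 * k))

theorem normConst_pos {k : ℝ} (hk : 1 / 2 < k) : 0 < normConst k := by
  have h1 : 0 < 2 * k - 1 := by linarith
  have h2 := Gamma_pos_of_pos (show 0 < k by linarith)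
  have h3 := Gamma_pos_of_pos (show 0 < 3 * k by linarith)
  have := pi_pos
  unfold normConst
  positivity

/-- The area of a section contributes `√m`, which turns the weight `Q ^ (k - 3/2)` into the
Dirichlet weight `m ^ (k - 1)`. -/
theorem sqrt_mul_rpow_sub {m k : ℝ} (hm : 0 < m) :
    √m * m ^ (k - 3 / 2) = m ^ (k - 1) := by
  rw [sqrt_eq_rpow, ← rpow_add hm]
  congr 1
  ring

theorem lintegral_Omega_rpow {k : ℝ} (hk : 1 / 2 < k) :
    ∫⁻ b in Omega, ENNReal.ofReal (Q b ^ (k - 3 / 2)) = ENNReal.ofReal (normConst k) := by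
  have hk1 : 0 < 2 * k - 1 := by linarith
  have hpi := pi_pos
  rw [lintegral_Omega (f := fun q => ENNReal.ofReal (q ^ (k - 3 / 2))) (by fun_prop), normConst,
    ENNReal.ofReal_mul (by positivity), ← lintegral_bary_rpow (by linarith),
    ← lintegral_const_mul' _ _ ENNReal.ofReal_ne_top]
  refine setLIntegral_congr_fun measurableSet_simplex fun a ha => ?_
  have hm := bary_pos ha
  have e : ∀ t ∈ Ioc (0 : ℝ) 1, ENNReal.ofReal ((bary a * t) ^ (k - 3 / 2))
      = ENNReal.ofReal (bary a ^ (k - 3 / 2)) * ENNReal.ofReal (t ^ ((k - 1 / 2) - 1)) := by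
    intro t ht
    rw [mul_rpow hm.le ht.1.le, ENNReal.ofReal_mul (by positivity)]
    ring_nf
  rw [setLIntegral_congr_fun measurableSet_Ioc e, lintegral_const_mul' _ _ ENNReal.ofReal_ne_top,
    lintegral_Ioc_rpow (by linarith) one_pos, ← ENNReal.ofReal_mul (by positivity),
    ← ENNReal.ofReal_mul (by positivity), ← ENNReal.ofReal_mul (by positivity),
    ← sqrt_mul_rpow_sub hm, one_rpow]
  congr 1
  have : k - 1 / 2 = (2 * k - 1) / 2 := by ring
  rw [this]
  field_simp

theorem rawMu_univ {k : ℝ} (hk : 1 / 2 < k) : rawMu k univ = ENNReal.ofReal (normConst k) := by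
  rw [rawMu, withDensity_apply _ MeasurableSet.univ, Measure.restrict_univ,
    lintegral_Omega_rpow hk]

theorem isProbabilityMeasure_mu {k : ℝ} (hk : 1 / 2 < k) : IsProbabilityMeasure (mu k) := by
  refine ⟨?_⟩
  rw [mu, Measure.smul_apply, smul_eq_mul, rawMu_univ hk]
  exact ENNReal.inv_mul_cancel (ENNReal.ofReal_pos.mpr (normConst_pos hk)).ne'
    ENNReal.ofReal_ne_top

theorem lintegral_rawMu {k : ℝ} {f : (Fin 4 → ℝ) → ℝ≥0∞} (hf : Measurable f) :
    ∫⁻ b, f b ∂(rawMu k) = ∫⁻ b in Omega, ENNReal.ofReal (Q b ^ (k - 3 / 2)) * f b := by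
  have : Measurable fun b => ENNReal.ofReal (Q b ^ (k - 3 / 2)) :=
    ENNReal.measurable_ofReal.comp (continuous_Q.measurable.pow_const _)
  rw [rawMu, lintegral_withDensity_eq_lintegral_mul _ this hf]
  rfl

/-- The mass of a sublevel set of `Q`, for a set of values that agrees with `[0, t]` up to a null
set. -/
theorem rawMu_preimage {k t : ℝ} (hk : 1 / 2 < k) (ht : 0 < t) {B : Set ℝ}
    (hB : MeasurableSet B) (hBt : ∀ q, 0 < q → 27 * q ≠ t → (q ∈ B ↔ 27 * q ≤ t)) :
    rawMu k (Q ⁻¹' B) = ∫⁻ a in simplex, ENNReal.ofReal (π * 27 ^ (1 - k) / (2 * k - 1)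
      * ((27 * bary a) ^ (k - 1) * min 1 (t / (27 * bary a)) ^ (k - 1 / 2))) := by
  have hk1 : 0 < 2 * k - 1 := by linarith
  have hpi := pi_pos
  have hQm : MeasurableSet (Q ⁻¹' B) := continuous_Q.measurable hB
  have h1 : rawMu k (Q ⁻¹' B) = ∫⁻ b in Omega,
      B.indicator (fun q => ENNReal.ofReal (q ^ (k - 3 / 2))) (Q b) := by
    rw [← lintegral_indicator_one hQm, lintegral_rawMu (measurable_one.indicator hQm)]
    refine lintegral_congr fun b => ?_
    by_cases hb : Q b ∈ B
    · rw [indicator_of_mem (show b ∈ Q ⁻¹' B from hb), indicator_of_mem hb, Pi.one_apply, mul_one]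
    · rw [indicator_of_notMem (show b ∉ Q ⁻¹' B from hb), indicator_of_notMem hb, mul_zero]
  rw [h1, lintegral_Omega (Measurable.indicator (by fun_prop) hB)]
  refine setLIntegral_congr_fun measurableSet_simplex fun a ha => ?_
  have hm := bary_pos ha
  set m := bary a
  -- On the section, `Q = m u` with `u ∈ (0, 1]`, so `27 Q ≤ t` means `u ≤ w`. The single point `u =
  -- t / (27 m)` is null, which lets strict and weak inequalities be treated together.
  set w := min 1 (t / (27 * m)) with hw
  have hw0 : 0 < w := lt_min one_pos (by positivity)
  have e : ∀ᵐ u, (Ioc (0 : ℝ) 1).indicator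
      (fun u => B.indicator (fun q => ENNReal.ofReal (q ^ (k - 3 / 2))) (m * u)) u
      = (Ioc 0 w).indicator (fun u => ENNReal.ofReal (m ^ (k - 3 / 2))
        * ENNReal.ofReal (u ^ ((k - 1 / 2) - 1))) u := by
    have hne : ∀ᵐ u : ℝ, u ≠ t / (27 * m) := by simp [ae_iff]
    filter_upwards [hne] with u hu
    by_cases hu1 : u ∈ Ioc (0 : ℝ) 1
    · have hmu : 0 < m * u := mul_pos hm hu1.1
      have hiff := hBt (m * u) hmu fun h => hu (by rw [← h]; field_simp)
      rw [indicator_of_mem hu1]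
      have hiff2 : 27 * (m * u) ≤ t ↔ u ∈ Ioc 0 w := by
        rw [mem_Ioc, hw, le_min_iff, le_div_iff₀ (by positivity)]
        constructor
        · intro h
          exact ⟨hu1.1, hu1.2, by linarith⟩
        · rintro ⟨_, _, h⟩
          linarith
      by_cases hb : m * u ∈ B
      · rw [indicator_of_mem hb, indicator_of_mem (hiff2.mp (hiff.mp hb)), mul_rpow hm.le hu1.1.le,
          ENNReal.ofReal_mul (by positivity)]
        ring_nf
      · rw [indicator_of_notMem hb, indicator_of_notMem fun h => hb (hiff.mpr (hiff2.mpr h))]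
    · rw [indicator_of_notMem hu1, indicator_of_notMem fun h =>
        hu1 ⟨h.1, h.2.trans (min_le_left _ _)⟩]
  rw [← lintegral_indicator measurableSet_Ioc, lintegral_congr_ae e,
    lintegral_indicator measurableSet_Ioc, lintegral_const_mul' _ _ ENNReal.ofReal_ne_top,
    lintegral_Ioc_rpow (by linarith) hw0, ← ENNReal.ofReal_mul (by positivity),
    ← ENNReal.ofReal_mul (by positivity)]
  congr 1
  have e2 : (27 : ℝ) ^ (1 - k) * 27 ^ (k - 1) = 1 := by
    rw [← rpow_add (by norm_num)]; simp
  rw [mul_rpow (by norm_num) hm.le, ← sqrt_mul_rpow_sub hm]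
  have : k - 1 / 2 = (2 * k - 1) / 2 := by ring
  rw [show π * 27 ^ (1 - k) / (2 * k - 1) * (27 ^ (k - 1) * (√m * m ^ (k - 3 / 2)) * w ^ (k - 1 / 2))
    = π / (2 * k - 1) * (27 ^ (1 - k) * 27 ^ (k - 1)) * (√m * m ^ (k - 3 / 2)) * w ^ (k - 1 / 2) by
      ring, e2, this]
  field_simp

/-- Cut at `u = t`. Below the cut the minimum is `1`; above it the integrand is `t ^ (k - 1/2) * u ^
(-1/2)` times the density, and its integral over `(t, 1]` is the full moment `2√3π` at `s = 1/2`
minus the part on `(0, t]`. -/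
theorem lintegral_min_rpow {k t : ℝ} (hk : 1 / 2 < k) (ht : 0 < t) (ht1 : t ≤ 1) :
    ∫⁻ u in Ioc (0 : ℝ) 1, ENNReal.ofReal (u ^ (k - 1) * min 1 (t / u) ^ (k - 1 / 2)) * logSeries u
      = ENNReal.ofReal ((∑' n, intTerm k t n)
        + t ^ (k - 1 / 2) * (2 * √3 * π - ∑' n, intTerm (1 / 2) t n)) := by
  have hsplit : ∀ f : ℝ → ℝ≥0∞, ∫⁻ u in Ioc (0 : ℝ) 1, f u
      = (∫⁻ u in Ioc 0 t, f u) + ∫⁻ u in Ioc t 1, f u := by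
    intro f
    rw [← Ioc_union_Ioc_eq_Ioc ht.le ht1, lintegral_union measurableSet_Ioc
      (Ioc_disjoint_Ioc_of_le le_rfl)]
  have e1 : ∀ u ∈ Ioc 0 t, ENNReal.ofReal (u ^ (k - 1) * min 1 (t / u) ^ (k - 1 / 2)) * logSeries u
      = ENNReal.ofReal (u ^ (k - 1)) * logSeries u := by
    intro u hu
    rw [min_eq_left ((one_le_div hu.1).mpr hu.2), one_rpow, mul_one]
  have e2 : ∀ u ∈ Ioc t 1, ENNReal.ofReal (u ^ (k - 1) * min 1 (t / u) ^ (k - 1 / 2)) * logSeries u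
      = ENNReal.ofReal (t ^ (k - 1 / 2))
        * (ENNReal.ofReal (u ^ ((1 / 2 : ℝ) - 1)) * logSeries u) := by
    intro u hu
    have hu0 : 0 < u := ht.trans hu.1
    rw [min_eq_right ((div_le_one hu0).mpr hu.1.le), div_rpow ht.le hu0.le, ← mul_assoc,
      ← ENNReal.ofReal_mul (by positivity)]
    congr 2
    rw [show k - 1 = (1 / 2 - 1) + (k - 1 / 2) by ring, rpow_add hu0]
    have := (rpow_pos_of_pos hu0 (k - 1 / 2)).ne'
    field_simp
  have hhalf := hsplit fun u => ENNReal.ofReal (u ^ ((1 / 2 : ℝ) - 1)) * logSeries u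
  rw [lintegral_rpow_mul_logSeries one_half_pos one_pos le_rfl, tsum_intTerm_half,
    lintegral_rpow_mul_logSeries one_half_pos ht ht1] at hhalf
  have hn : 0 ≤ ∑' n, intTerm (1 / 2) t n := tsum_nonneg (intTerm_nonneg one_half_pos ht ht1)
  have hnk : 0 ≤ ∑' n, intTerm k t n := tsum_nonneg (intTerm_nonneg (by linarith) ht ht1)
  have hle : ∑' n, intTerm (1 / 2) t n ≤ 2 * √3 * π := by
    rw [← ENNReal.ofReal_le_ofReal_iff (by positivity), hhalf]
    exact le_self_add
  have htail : ∫⁻ u in Ioc t 1, ENNReal.ofReal (u ^ ((1 / 2 : ℝ) - 1)) * logSeries u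
      = ENNReal.ofReal (2 * √3 * π - ∑' n, intTerm (1 / 2) t n) := by
    rw [ENNReal.ofReal_sub _ hn, hhalf, ENNReal.add_sub_cancel_left ENNReal.ofReal_ne_top]
  rw [hsplit, setLIntegral_congr_fun measurableSet_Ioc e1,
    setLIntegral_congr_fun measurableSet_Ioc e2, lintegral_const_mul' _ _ ENNReal.ofReal_ne_top,
    htail, lintegral_rpow_mul_logSeries (by linarith) ht ht1,
    ← ENNReal.ofReal_mul (by positivity), ← ENNReal.ofReal_add hnk
    (mul_nonneg (by positivity) (by linarith))]

/-- Partial fractions: `1/(n + k) - 1/(n + 1/2)` produces the denominator `(2n + 1)(n + k)` and the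
factor `-(2k - 1)`. The difference of the squares is this times the sum `1/(n + k) + 2/(2n + 1)`. -/
theorem intTerm_sub {k x : ℝ} (hk : 1 / 2 < k) (hx : 0 < x) (n : ℕ) :
    intTerm k (x ^ 2) n - (x ^ 2) ^ (k - 1 / 2) * intTerm (1 / 2) (x ^ 2) n
      = -((2 * k - 1) * x ^ (2 * k - 1)) * cdfTerm k x n := by
  have hn : (0 : ℝ) ≤ n := n.cast_nonneg
  have h27 : log (x ^ 2 / 27) = log (x ^ 2) - log 27 :=
    log_div (by positivity) (by norm_num)
  have p2 : ∀ z : ℝ, (x ^ 2) ^ z = x ^ (2 * z) := fun z => by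
    rw [← rpow_natCast x 2, ← rpow_mul hx.le, Nat.cast_ofNat]
  have e1 : x ^ (2 * ((n : ℝ) + k)) = x ^ (2 * k - 1) * x ^ (2 * n + 1) := by
    rw [← rpow_natCast x (2 * n + 1), ← rpow_add hx]
    push_cast
    ring_nf
  have e2 : x ^ (2 * ((n : ℝ) + 1 / 2)) = x ^ (2 * n + 1) := by
    rw [← rpow_natCast x (2 * n + 1)]
    push_cast
    ring_nf
  have e3 : x ^ (2 * (k - 1 / 2)) = x ^ (2 * k - 1) := by ring_nf
  rw [intTerm, intTerm, p2, p2, p2, e1, e2, e3, cdfTerm, h27, coefA, coefL]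
  set S := ∑ j ∈ Finset.Icc (n + 1) (3 * n), (3 : ℝ) / (j : ℝ)
  have h1 : (n : ℝ) + k ≠ 0 := by linarith
  have h2 : (n : ℝ) + 1 / 2 = (2 * n + 1) / 2 := by ring
  rw [h2]
  have h3 : (2 * (n : ℝ) + 1) ≠ 0 := by positivity
  field_simp
  ring

theorem summable_cdfTerm {k x : ℝ} (hk : 1 / 2 < k) (hx : 0 < x) (hx1 : x ≤ 1) :
    Summable (cdfTerm k x) := by
  have ht : 0 < x ^ 2 := by positivity
  have ht1 : x ^ 2 ≤ 1 := pow_le_one₀ hx.le hx1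
  have h1 := (summable_intTerm (by linarith : 0 < k) ht ht1).sub
    ((summable_intTerm one_half_pos ht ht1).mul_left ((x ^ 2) ^ (k - 1 / 2)))
  have hk1 : 0 < 2 * k - 1 := by linarith
  have hne : -((2 * k - 1) * x ^ (2 * k - 1)) ≠ 0 := neg_ne_zero.mpr (by positivity)
  refine (summable_mul_left_iff hne).mp ?_
  simpa only [intTerm_sub hk hx] using h1

theorem tsum_cdfTerm {k x : ℝ} (hk : 1 / 2 < k) (hx : 0 < x) (hx1 : x ≤ 1) :
    (∑' n, intTerm k (x ^ 2) n) - (x ^ 2) ^ (k - 1 / 2) * ∑' n, intTerm (1 / 2) (x ^ 2) n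
      = -((2 * k - 1) * x ^ (2 * k - 1)) * ∑' n, cdfTerm k x n := by
  have ht : 0 < x ^ 2 := by positivity
  have ht1 : x ^ 2 ≤ 1 := pow_le_one₀ hx.le hx1
  rw [← tsum_mul_left, ← tsum_mul_left, ← (summable_intTerm (by linarith : 0 < k) ht ht1).tsum_sub
    ((summable_intTerm one_half_pos ht ht1).mul_left ((x ^ 2) ^ (k - 1 / 2)))]
  exact tsum_congr fun n => intTerm_sub hk hx n

/-- The mass of a sublevel set of `Q` under the normalised measure. -/
theorem mu_real_preimage {k x : ℝ} (hk : 1 / 2 < k) (hx : 0 < x) (hx1 : x ≤ 1) {B : Set ℝ}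
    (hB : MeasurableSet B) (hBt : ∀ q, 0 < q → 27 * q ≠ x ^ 2 → (q ∈ B ↔ 27 * q ≤ x ^ 2)) :
    (mu k).real (Q ⁻¹' B) = cdf k x := by
  have ht : 0 < x ^ 2 := by positivity
  have ht1 : x ^ 2 ≤ 1 := pow_le_one₀ hx.le hx1
  have hk0 : 0 < k := by linarith
  have hk1 : 0 < 2 * k - 1 := by linarith
  have hpi := pi_pos
  set C := π * 27 ^ (1 - k) / (2 * k - 1) with hC
  have hC0 : 0 < C := by positivity
  have hraw : rawMu k (Q ⁻¹' B) = ENNReal.ofReal (1 / 9 * (C * ((∑' n, intTerm k (x ^ 2) n)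
        + (x ^ 2) ^ (k - 1 / 2) * (2 * √3 * π - ∑' n, intTerm (1 / 2) (x ^ 2) n)))) := by
    rw [rawMu_preimage hk ht hB hBt, lintegral_comp_bary (g := fun u => ENNReal.ofReal
      (C * (u ^ (k - 1) * min 1 (x ^ 2 / u) ^ (k - 1 / 2)))) (by fun_prop)]
    simp_rw [fun u => ENNReal.ofReal_mul (q := u) hC0.le, mul_assoc (ENNReal.ofReal C)]
    rw [lintegral_const_mul' _ _ ENNReal.ofReal_ne_top, lintegral_min_rpow hk ht ht1,
      ← ENNReal.ofReal_mul hC0.le, ← ENNReal.ofReal_mul (by norm_num)]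
  have hnn : 0 ≤ 1 / 9 * (C * ((∑' n, intTerm k (x ^ 2) n)
        + (x ^ 2) ^ (k - 1 / 2) * (2 * √3 * π - ∑' n, intTerm (1 / 2) (x ^ 2) n))) := by
    have h1 : 0 ≤ ∑' n, intTerm k (x ^ 2) n := tsum_nonneg (intTerm_nonneg hk0 ht ht1)
    have h2 : ∑' n, intTerm (1 / 2) (x ^ 2) n ≤ 2 * √3 * π := by
      rw [← tsum_intTerm_half, ← ENNReal.ofReal_le_ofReal_iff
        (tsum_nonneg (intTerm_nonneg one_half_pos one_pos le_rfl)),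
        ← lintegral_rpow_mul_logSeries one_half_pos ht ht1,
        ← lintegral_rpow_mul_logSeries one_half_pos one_pos le_rfl]
      exact lintegral_mono_set (Ioc_subset_Ioc_right ht1)
    have h3 : 0 ≤ (x ^ 2) ^ (k - 1 / 2) := by positivity
    have h4 := mul_nonneg h3 (sub_nonneg.mpr h2)
    positivity
  rw [measureReal_def, mu, Measure.smul_apply, smul_eq_mul, hraw, rawMu_univ hk,
    ENNReal.toReal_mul, ENNReal.toReal_inv, ENNReal.toReal_ofReal (normConst_pos hk).le,
    ENNReal.toReal_ofReal hnn, mul_sub, show ∀ a b c : ℝ, a + (b - c) = b + (a - c) by intros; ring,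
    tsum_cdfTerm hk hx hx1, cdf]
  have e3 : (x ^ 2) ^ (k - 1 / 2) = x ^ (2 * k - 1) := by
    rw [← rpow_natCast x 2, ← rpow_mul hx.le]
    congr 1
    push_cast
    ring
  rw [e3]
  set T := ∑' n, cdfTerm k x n
  set X := x ^ (2 * k - 1)
  -- The normalising constant contains `Γ(3k) / Γ(k)³`; triplication rewrites it through `Γ(k + 1/3)
  -- Γ(k + 2/3) / Γ(k)²`, that is `c_k`.
  have htri := Gamma_triplication hk0
  have h27 : (3 : ℝ) ^ (3 * k) = 27 ^ k := by
    rw [rpow_mul (by norm_num), show (3 : ℝ) ^ (3 : ℝ) = 27 by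
      rw [show (3 : ℝ) = ((3 : ℕ) : ℝ) by norm_num, rpow_natCast]; norm_num]
  have hg := Gamma_pos_of_pos hk0
  have hg3 := Gamma_pos_of_pos (show 0 < 3 * k by linarith)
  have h27k : (27 : ℝ) ^ (1 - k) = 27 / 27 ^ k := by
    rw [rpow_sub (by norm_num), rpow_one]
  have h27p : (0 : ℝ) < 27 ^ k := by positivity
  rw [h27] at htri
  have hc : c k = 2 * √3 * π * Gamma (3 * k) / (27 ^ k * Gamma k ^ 3) := by
    rw [c, ← htri]
    field_simp
  rw [hc, hC, normConst, h27k, show k - 1 / 2 = (2 * k - 1) / 2 by ring]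
  have hs : (√3 : ℝ) ≠ 0 := by positivity
  have h3 : (√3 : ℝ) ^ 2 = 3 := sq_sqrt (by norm_num)
  field_simp
  linear_combination (9 * X * (2 * k - 1) * T) * h3

/-- No sign condition on `q` is needed: for `q < 0` the root is `0` and both sides hold. -/
theorem three_mul_sqrt_le_iff {q x : ℝ} (hx : 0 < x) :
    6 * √3 * (√q / 2) ≤ x ↔ 27 * q ≤ x ^ 2 := by
  rw [show 6 * √3 * (√q / 2) = 3 * (√3 * √q) by ring, ← sqrt_mul (by norm_num),
    ← le_div_iff₀' (by norm_num), sqrt_le_iff, and_iff_right (by positivity), div_pow,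
    le_div_iff₀ (by norm_num)]
  constructor <;> intro h <;> linarith

theorem mu_real_absJ_le {k x : ℝ} (hk : 1 / 2 < k) (hx : 0 < x) (hx1 : x ≤ 1) :
    (mu k).real {b | 6 * √3 * absJ b ≤ x} = cdf k x :=
  mu_real_preimage (B := {q | 6 * √3 * (√q / 2) ≤ x}) hk hx hx1
    (measurableSet_le (by fun_prop) measurable_const) fun q _ _ => three_mul_sqrt_le_iff hx

theorem mu_real_absJ_lt {k x : ℝ} (hk : 1 / 2 < k) (hx : 0 < x) (hx1 : x ≤ 1) :
    (mu k).real {b | 6 * √3 * absJ b < x} = cdf k x := by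
  refine mu_real_preimage (B := {q | 6 * √3 * (√q / 2) < x}) hk hx hx1
    (measurableSet_lt (by fun_prop) measurable_const) fun q hq hne => ?_
  rw [← three_mul_sqrt_le_iff hx]
  refine ⟨fun h => le_of_lt h, fun h => lt_of_le_of_ne h fun he => hne ?_⟩
  have h3 : √3 ^ 2 = 3 := sq_sqrt (by norm_num)
  have h4 : √q ^ 2 = q := sq_sqrt hq.le
  rw [← he, mul_pow, mul_pow, div_pow, h3, h4]
  ring

theorem mu_real_absJ_le_div {k y : ℝ} (hk : 1 / 2 < k) (hy : 0 < y) (hy1 : y ≤ 1 / (6 * √3)) :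
    (mu k).real {b | absJ b ≤ y} = cdf k (6 * √3 * y) := by
  have hc : 0 < 6 * √3 := by positivity
  rw [← mu_real_absJ_le hk (by positivity) (by rwa [le_div_iff₀' hc] at hy1)]
  congr 1
  ext b
  exact (mul_le_mul_iff_right₀ hc).symm

/-! ### Expansions in `y` for `k = 1` and `k = 3/2`. -/

/-- The coefficients of the logarithmic part of the distribution function. -/
noncomputable def logCoef (k : ℝ) (n : ℕ) : ℝ := coefA n / ((2 * n + 1) * (n + k))

/-- The non-logarithmic factors in the distribution function. -/
noncomputable def regFactor (k : ℝ) (n : ℕ) : ℝ :=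
  -(∑ j ∈ Finset.Icc (n + 1) (3 * n), (3 : ℝ) / (j : ℝ)) + 2 / (2 * n + 1) + 1 / (n + k)

theorem cdfTerm_eq (k x : ℝ) (n : ℕ) :
    cdfTerm k x n = -log (x ^ 2 / 27) * (logCoef k n * x ^ (2 * n + 1))
      + logCoef k n * regFactor k n * x ^ (2 * n + 1) := by
  unfold cdfTerm logCoef regFactor coefA
  rw [div_div]
  ring

theorem summable_logCoef {k x : ℝ} (hk : 0 < k) (hx : 0 < x) (hx1 : x ≤ 1) :
    Summable fun n : ℕ => logCoef k n * x ^ (2 * n + 1) := by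
  have hsum : Summable fun n : ℕ => (1 + 1 / k) * (1 / ((n : ℝ) + 1) ^ 2) := by
    refine Summable.mul_left _ ?_
    have := (summable_nat_add_iff 1).mpr (summable_one_div_nat_pow.mpr one_lt_two)
    simpa using this
  refine Summable.of_nonneg_of_le (fun n => ?_) (fun n => ?_) hsum
  · have := coefA_pos n
    unfold logCoef
    positivity
  · have hA := coefA_pos n
    have h1 : coefA n / (2 * n + 1) ≤ 1 / ((n : ℝ) + 1) :=
      (div_le_self hA.le (by linarith [(n.cast_nonneg : (0 : ℝ) ≤ n)])).trans (coefA_le n)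
    have h2 := one_div_add_le hk n
    have h3 : x ^ (2 * n + 1) ≤ 1 := pow_le_one₀ hx.le hx1
    calc logCoef k n * x ^ (2 * n + 1) ≤ logCoef k n :=
          mul_le_of_le_one_right (by unfold logCoef; positivity) h3
      _ = coefA n / (2 * n + 1) * (1 / (n + k)) := by unfold logCoef; field_simp
      _ ≤ 1 / ((n : ℝ) + 1) * ((1 + 1 / k) * (1 / ((n : ℝ) + 1))) :=
          mul_le_mul h1 h2 (by positivity) (by positivity)
      _ = _ := by field_simp

/-- Obtained by subtracting the summable logarithmic part from the summable full series, so no bound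
on `regFactor` is required. -/
theorem summable_regFactor {k x : ℝ} (hk : 1 / 2 < k) (hx : 0 < x) (hx1 : x ≤ 1) :
    Summable fun n : ℕ => logCoef k n * regFactor k n * x ^ (2 * n + 1) := by
  have h := (summable_cdfTerm hk hx hx1).sub
    ((summable_logCoef (by linarith : 0 < k) hx hx1).mul_left (-log (x ^ 2 / 27)))
  refine h.congr fun n => ?_
  rw [cdfTerm_eq]
  ring

theorem tsum_cdfTerm_eq {k x : ℝ} (hk : 1 / 2 < k) (hx : 0 < x) (hx1 : x ≤ 1) :
    ∑' n, cdfTerm k x n = -log (x ^ 2 / 27) * (∑' n : ℕ, logCoef k n * x ^ (2 * n + 1))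
      + ∑' n : ℕ, logCoef k n * regFactor k n * x ^ (2 * n + 1) := by
  simp_rw [cdfTerm_eq]
  rw [((summable_logCoef (by linarith : 0 < k) hx hx1).mul_left _).tsum_add
    (summable_regFactor hk hx hx1), tsum_mul_left]

theorem six_sqrt_three_sq : (6 * √3) ^ 2 = 108 := by
  rw [mul_pow, sq_sqrt (by norm_num)]; norm_num

theorem c_one : c 1 = 4 * √3 * π / 27 := by
  have h := Gamma_one_third_mul_Gamma_two_thirds
  rw [c, show (1 : ℝ) + 1 / 3 = 1 / 3 + 1 by norm_num, show (1 : ℝ) + 2 / 3 = 2 / 3 + 1 by norm_num,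
    Gamma_add_one (by norm_num), Gamma_add_one (by norm_num), Gamma_one]
  linear_combination (2 / 9 : ℝ) * h

theorem c_three_halves : c (3 / 2) = 35 / 27 := by
  have h := Gamma_mul_Gamma_one_sub (1 / 6)
  rw [show (1 : ℝ) - 1 / 6 = 5 / 6 by norm_num, show π * (1 / 6) = π / 6 by ring,
    sin_pi_div_six] at h
  have hp : √π ^ 2 = π := sq_sqrt pi_pos.le
  have hpi := pi_pos.ne'
  rw [c, show (3 : ℝ) / 2 + 1 / 3 = 5 / 6 + 1 by norm_num,
    show (3 : ℝ) / 2 + 2 / 3 = 1 / 6 + 1 + 1 by norm_num,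
    show (3 : ℝ) / 2 = 1 / 2 + 1 by norm_num, Gamma_add_one (by norm_num),
    Gamma_add_one (by norm_num), Gamma_add_one (by norm_num), Gamma_add_one (by norm_num),
    Gamma_one_half_eq, mul_pow, hp, div_eq_iff (by positivity)]
  linear_combination (35 / 216 : ℝ) * h

theorem coefA_one : coefA 1 = 2 / 9 := by
  have h := coefA_succ 0
  rw [coefA_zero] at h
  norm_num at h
  exact h

theorem coefA_two : coefA 2 = 10 / 81 := by
  have h := coefA_succ 1
  rw [coefA_one] at h
  norm_num at h
  linarith

theorem pos_and_le_one_of_le_div {y : ℝ} (hy : 0 < y) (hy1 : y ≤ 1 / (6 * √3)) :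
    0 < 6 * √3 * y ∧ 6 * √3 * y ≤ 1 :=
  ⟨by positivity, by rwa [le_div_iff₀' (by positivity)] at hy1⟩

theorem mu_one_series :
    ∃ a d : ℕ → ℝ, a 0 = 1 ∧ a 1 = 4 ∧ a 2 = 96 ∧ d 0 = -72 ∧ d 1 = 128 ∧ d 2 = 24384 / 5 ∧
      ∀ y : ℝ, 0 < y → y ≤ 1 / (6 * √3) →
        Summable (fun n : ℕ => a n * y ^ (2 * n + 2)) ∧
        Summable (fun n : ℕ => d n * y ^ (2 * n + 2)) ∧
        (mu 1).real {b | absJ b ≤ y} = 8 * π * y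
          + 24 * log (4 * y ^ 2) * ∑' n : ℕ, a n * y ^ (2 * n + 2)
          + ∑' n : ℕ, d n * y ^ (2 * n + 2) := by
  -- With `x = 6√3 y` one has `x² = 108 y²` and `x² / 27 = 4 y²`. The factor `24` is `c 1 * √3 /
  -- (2π) * 108`.
  refine ⟨fun n => 108 ^ n * logCoef 1 n, fun n => -24 * 108 ^ n * (logCoef 1 n * regFactor 1 n),
    ?_, ?_, ?_, ?_, ?_, ?_, fun y hy hy1 => ?_⟩
  · simp [logCoef, coefA_zero]
  · norm_num [logCoef, coefA_one]
  · norm_num [logCoef, coefA_two]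
  · norm_num [logCoef, regFactor, coefA_zero]
  · norm_num [logCoef, regFactor, coefA_one, Finset.sum_Icc_succ_top]
  · norm_num [logCoef, regFactor, coefA_two, Finset.sum_Icc_succ_top]
  · obtain ⟨hx, hx1⟩ := pos_and_le_one_of_le_div hy hy1
    have hk : (1 : ℝ) / 2 < 1 := by norm_num
    have hpow : ∀ n : ℕ, (108 : ℝ) ^ n * y ^ (2 * n + 2)
        = y / (6 * √3) * (6 * √3 * y) ^ (2 * n + 1) := by
      intro n
      rw [mul_pow, pow_succ (6 * √3), pow_mul, six_sqrt_three_sq]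
      field_simp
      ring
    have ea : ∀ n : ℕ, 108 ^ n * logCoef 1 n * y ^ (2 * n + 2)
        = y / (6 * √3) * (logCoef 1 n * (6 * √3 * y) ^ (2 * n + 1)) := fun n => by
      linear_combination logCoef 1 n * hpow n
    have ed : ∀ n : ℕ, -24 * 108 ^ n * (logCoef 1 n * regFactor 1 n) * y ^ (2 * n + 2)
        = -24 * (y / (6 * √3)) * (logCoef 1 n * regFactor 1 n * (6 * √3 * y) ^ (2 * n + 1)) :=
      fun n => by linear_combination (-24 * (logCoef 1 n * regFactor 1 n)) * hpow n
    simp_rw [ea, ed]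
    refine ⟨(summable_logCoef one_pos hx hx1).mul_left _,
      (summable_regFactor hk hx hx1).mul_left _, ?_⟩
    rw [mu_real_absJ_le_div hk hy hy1, cdf, tsum_cdfTerm_eq hk hx hx1, tsum_mul_left,
      tsum_mul_left, c_one, show (2 : ℝ) * 1 - 1 = 1 by norm_num, rpow_one]
    have e4 : (6 * √3 * y) ^ 2 / 27 = 4 * y ^ 2 := by
      rw [mul_pow, six_sqrt_three_sq]; ring
    rw [e4]
    generalize (∑' n : ℕ, logCoef 1 n * (6 * √3 * y) ^ (2 * n + 1)) = S
    generalize (∑' n : ℕ, logCoef 1 n * regFactor 1 n * (6 * √3 * y) ^ (2 * n + 1)) = T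
    generalize log (4 * y ^ 2) = l
    have h3 : √3 ^ 2 = 3 := sq_sqrt (by norm_num)
    have hpi := pi_pos.ne'
    have e5 : y / (6 * √3) = y * √3 / 18 := by
      field_simp
      rw [h3]
      norm_num
    rw [e5]
    field_simp
    rw [h3]
    ring

theorem mu_three_halves_series :
    ∃ a d : ℕ → ℝ, a 0 = 1680 / π ∧ d 0 = -(4480 / π) ∧
      ∀ y : ℝ, 0 < y → y ≤ 1 / (6 * √3) →
        Summable (fun n : ℕ => a n * y ^ (2 * n + 3)) ∧
        Summable (fun n : ℕ => d n * y ^ (2 * n + 3)) ∧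
        (mu (3 / 2)).real {b | absJ b ≤ y} = 420 * y ^ 2
          + log (4 * y ^ 2) * ∑' n : ℕ, a n * y ^ (2 * n + 3)
          + ∑' n : ℕ, d n * y ^ (2 * n + 3) := by
  have hpi := pi_pos.ne'
  -- The prefactor is `2 * c (3/2) * √3 / (2π) * (6√3)³ = 2520 / π`.
  refine ⟨fun n => 2520 / π * 108 ^ n * logCoef (3 / 2) n,
    fun n => -(2520 / π) * 108 ^ n * (logCoef (3 / 2) n * regFactor (3 / 2) n),
    ?_, ?_, fun y hy hy1 => ?_⟩
  · simp only [logCoef, coefA_zero]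
    field_simp
    norm_num
  · simp only [logCoef, regFactor, coefA_zero]
    field_simp
    norm_num
  · obtain ⟨hx, hx1⟩ := pos_and_le_one_of_le_div hy hy1
    have hk : (1 : ℝ) / 2 < 3 / 2 := by norm_num
    have hpow : ∀ n : ℕ, (108 : ℝ) ^ n * y ^ (2 * n + 3)
        = y ^ 2 / (6 * √3) * (6 * √3 * y) ^ (2 * n + 1) := by
      intro n
      rw [mul_pow, pow_succ (6 * √3), pow_mul, six_sqrt_three_sq]
      field_simp
      ring
    have ea : ∀ n : ℕ, 2520 / π * 108 ^ n * logCoef (3 / 2) n * y ^ (2 * n + 3)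
        = 2520 / π * (y ^ 2 / (6 * √3)) * (logCoef (3 / 2) n * (6 * √3 * y) ^ (2 * n + 1)) :=
      fun n => by linear_combination (2520 / π * logCoef (3 / 2) n) * hpow n
    have ed : ∀ n : ℕ, -(2520 / π) * 108 ^ n * (logCoef (3 / 2) n * regFactor (3 / 2) n)
          * y ^ (2 * n + 3)
        = -(2520 / π) * (y ^ 2 / (6 * √3))
          * (logCoef (3 / 2) n * regFactor (3 / 2) n * (6 * √3 * y) ^ (2 * n + 1)) :=
      fun n => by
        linear_combination (-(2520 / π) * (logCoef (3 / 2) n * regFactor (3 / 2) n)) * hpow n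
    simp_rw [ea, ed]
    refine ⟨(summable_logCoef (by norm_num) hx hx1).mul_left _,
      (summable_regFactor hk hx hx1).mul_left _, ?_⟩
    rw [mu_real_absJ_le_div hk hy hy1, cdf, tsum_cdfTerm_eq hk hx hx1, tsum_mul_left,
      tsum_mul_left, c_three_halves, show (2 : ℝ) * (3 / 2) - 1 = 2 by norm_num, rpow_two]
    have e4 : (6 * √3 * y) ^ 2 / 27 = 4 * y ^ 2 := by
      rw [mul_pow, six_sqrt_three_sq]; ring
    have e6 : (6 * √3 * y) ^ 2 = 108 * y ^ 2 := by
      rw [mul_pow, six_sqrt_three_sq]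
    rw [e4, e6]
    generalize (∑' n : ℕ, logCoef (3 / 2) n * (6 * √3 * y) ^ (2 * n + 1)) = S
    generalize (∑' n : ℕ, logCoef (3 / 2) n * regFactor (3 / 2) n * (6 * √3 * y) ^ (2 * n + 1)) = T
    generalize log (4 * y ^ 2) = l
    have h3 : √3 ^ 2 = 3 := sq_sqrt (by norm_num)
    have e5 : y ^ 2 / (6 * √3) = y ^ 2 * √3 / 18 := by
      field_simp
      rw [h3]
      norm_num
    rw [e5]
    field_simp
    ring

/-! ### Gaussian integrals on `ℂᵈ`. -/

theorem lintegral_vecMul_unitary {d : ℕ} {V : Matrix (Fin d) (Fin d) ℂ}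
    (hV : V ∈ Matrix.unitaryGroup (Fin d) ℂ) {f : (Fin d → ℂ) → ℝ≥0∞} (hf : Measurable f) :
    ∫⁻ z, f (z ᵥ* V) = ∫⁻ z, f z := by
  set T : (Fin d → ℂ) →ₗ[ℝ] (Fin d → ℂ) := (Matrix.toLin' Vᵀ).restrictScalars ℝ with hT
  have hTz : ∀ z, T z = z ᵥ* V := fun z => by
    rw [hT, LinearMap.coe_restrictScalars, Matrix.toLin'_apply, Matrix.mulVec_transpose]
  -- The real determinant of a complex linear map is the squared modulus of its complex determinant.
  have hdet : LinearMap.det T = 1 := by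
    rw [hT, LinearMap.det_restrictScalars, LinearMap.det_toLin', Matrix.det_transpose,
      Algebra.norm_complex_apply, Complex.normSq_eq_norm_sq]
    have h1 := congrArg Matrix.det (Matrix.mem_unitaryGroup_iff.mp hV)
    rw [Matrix.det_mul, Matrix.star_eq_conjTranspose, Matrix.det_conjTranspose, Matrix.det_one,
      Complex.star_def, Complex.mul_conj, Complex.normSq_eq_norm_sq] at h1
    exact_mod_cast h1
  have hm := Measure.map_linearMap_addHaar_eq_smul_addHaar (volume : Measure (Fin d → ℂ))
    (f := T) (by rw [hdet]; exact one_ne_zero)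
  rw [hdet, inv_one, abs_one, ENNReal.ofReal_one, one_smul] at hm
  simp_rw [← hTz]
  rw [← lintegral_map hf (LinearMap.continuous_of_finiteDimensional T).measurable, hm]

theorem sum_norm_sq_vecMul_unitary {d : ℕ} {V : Matrix (Fin d) (Fin d) ℂ}
    (hV : V ∈ Matrix.unitaryGroup (Fin d) ℂ) (z : Fin d → ℂ) :
    ∑ i, ‖(z ᵥ* V) i‖ ^ 2 = ∑ i, ‖z i‖ ^ 2 := by
  have key : ∀ w : Fin d → ℂ, ((∑ i, ‖w i‖ ^ 2 : ℝ) : ℂ) = w ⬝ᵥ star w := by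
    intro w
    simp [dotProduct, Complex.mul_conj, Complex.normSq_eq_norm_sq]
  have h : ((∑ i, ‖(z ᵥ* V) i‖ ^ 2 : ℝ) : ℂ) = ((∑ i, ‖z i‖ ^ 2 : ℝ) : ℂ) := by
    rw [key, key, Matrix.star_vecMul, ← Matrix.dotProduct_mulVec, Matrix.mulVec_mulVec,
      ← Matrix.star_eq_conjTranspose, Matrix.mem_unitaryGroup_iff.mp hV, Matrix.one_mulVec]
  exact_mod_cast h

/-- The integral of a function against the unnormalised Gaussian density on `ℂᵈ`. -/
noncomputable def gaussInt {d : ℕ} (f : (Fin d → ℂ) → ℝ≥0∞) : ℝ≥0∞ :=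
  ∫⁻ z, ENNReal.ofReal (rexp (-∑ i, ‖z i‖ ^ 2)) * f z

theorem gaussInt_vecMul_unitary {d : ℕ} {V : Matrix (Fin d) (Fin d) ℂ}
    (hV : V ∈ Matrix.unitaryGroup (Fin d) ℂ) {f : (Fin d → ℂ) → ℝ≥0∞} (hf : Measurable f) :
    gaussInt (fun z => f (z ᵥ* V)) = gaussInt f := by
  unfold gaussInt
  rw [← lintegral_vecMul_unitary hV
    (f := fun z => ENNReal.ofReal (rexp (-∑ i, ‖z i‖ ^ 2)) * f z) (by fun_prop)]
  simp_rw [sum_norm_sq_vecMul_unitary hV]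

theorem integral_norm_sq_pow_mul_exp (k : ℕ) :
    ∫ z : ℂ, (‖z‖ ^ 2) ^ k * rexp (-‖z‖ ^ 2) = π * k.factorial := by
  have h := Complex.integral_rpow_mul_exp_neg_rpow (p := 2) (q := 2 * k) (by norm_num)
    (by linarith [(k.cast_nonneg : (0 : ℝ) ≤ k)])
  rw [show (2 * (k : ℝ) + 2) / 2 = k + 1 by ring, Gamma_nat_eq_factorial,
    show 2 * π / 2 = π by ring] at h
  rw [← h]
  congr 1
  funext z
  rw [rpow_two, ← pow_mul, ← rpow_natCast]
  push_cast
  ring_nf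

theorem integrable_norm_sq_pow_mul_exp (k : ℕ) :
    Integrable fun z : ℂ => (‖z‖ ^ 2) ^ k * rexp (-‖z‖ ^ 2) := by
  refine Integrable.of_integral_ne_zero ?_
  rw [integral_norm_sq_pow_mul_exp]
  have := pi_pos
  positivity

theorem exp_mul_prod_eq {d : ℕ} (k : Fin d → ℕ) (z : Fin d → ℂ) :
    rexp (-∑ i, ‖z i‖ ^ 2) * ∏ i, (‖z i‖ ^ 2) ^ k i
      = ∏ i, ((‖z i‖ ^ 2) ^ k i * rexp (-‖z i‖ ^ 2)) := by
  rw [Finset.prod_mul_distrib, ← exp_sum, Finset.sum_neg_distrib, mul_comm]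

theorem integrable_exp_mul_monomial {d : ℕ} (k : Fin d → ℕ) :
    Integrable fun z : Fin d → ℂ => rexp (-∑ i, ‖z i‖ ^ 2) * ∏ i, (‖z i‖ ^ 2) ^ k i := by
  simp_rw [exp_mul_prod_eq]
  exact Integrable.fintype_prod (f := fun i (w : ℂ) => (‖w‖ ^ 2) ^ k i * rexp (-‖w‖ ^ 2))
    fun i => integrable_norm_sq_pow_mul_exp (k i)

theorem integral_exp_mul_monomial {d : ℕ} (k : Fin d → ℕ) :
    ∫ z : Fin d → ℂ, rexp (-∑ i, ‖z i‖ ^ 2) * ∏ i, (‖z i‖ ^ 2) ^ k i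
      = ∏ i, (π * (k i).factorial) := by
  simp_rw [exp_mul_prod_eq]
  rw [integral_fintype_prod_volume_eq_prod
    (f := fun i (w : ℂ) => (‖w‖ ^ 2) ^ k i * rexp (-‖w‖ ^ 2))]
  exact Finset.prod_congr rfl fun i _ => integral_norm_sq_pow_mul_exp (k i)

/-- Gaussian integrals of nonnegative functions that are combinations of monomials in the squared
norms of the coordinates. -/
theorem gaussInt_eq_sum {d : ℕ} {ι : Type*} (s : Finset ι) (a : ι → ℝ) (k : ι → Fin d → ℕ)
    {f : (Fin d → ℂ) → ℝ} (hf : ∀ z, 0 ≤ f z)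
    (h : ∀ z, f z = ∑ j ∈ s, a j * ∏ i, (‖z i‖ ^ 2) ^ k j i) :
    gaussInt (fun z => ENNReal.ofReal (f z))
      = ENNReal.ofReal (∑ j ∈ s, a j * ∏ i, (π * (k j i).factorial)) := by
  have e : ∀ z : Fin d → ℂ, rexp (-∑ i, ‖z i‖ ^ 2) * f z
      = ∑ j ∈ s, a j * (rexp (-∑ i, ‖z i‖ ^ 2) * ∏ i, (‖z i‖ ^ 2) ^ k j i) := by
    intro z
    rw [h, Finset.mul_sum]
    exact Finset.sum_congr rfl fun j _ => by ring
  have hint : ∀ j ∈ s, Integrable fun z : Fin d → ℂ =>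
      a j * (rexp (-∑ i, ‖z i‖ ^ 2) * ∏ i, (‖z i‖ ^ 2) ^ k j i) :=
    fun j _ => (integrable_exp_mul_monomial (k j)).const_mul _
  have hi : Integrable fun z : Fin d → ℂ => rexp (-∑ i, ‖z i‖ ^ 2) * f z := by
    simp_rw [e]
    exact integrable_finsetSum _ hint
  have hv : ∫ z : Fin d → ℂ, rexp (-∑ i, ‖z i‖ ^ 2) * f z
      = ∑ j ∈ s, a j * ∏ i, (π * (k j i).factorial) := by
    simp_rw [e]
    rw [integral_finsetSum _ hint]
    refine Finset.sum_congr rfl fun j _ => ?_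
    rw [integral_const_mul, integral_exp_mul_monomial]
  rw [← hv, ofReal_integral_eq_lintegral_ofReal hi (ae_of_all _ fun z =>
    mul_nonneg (exp_pos _).le (hf z))]
  unfold gaussInt
  exact lintegral_congr fun z => (ENNReal.ofReal_mul (exp_pos _).le).symm

theorem choose_mul_factorials {m i : ℕ} (h : i ∈ Finset.range (m + 1)) :
    (m.choose i : ℝ) * i.factorial * (m - i).factorial = m.factorial := by
  exact_mod_cast Nat.choose_mul_factorial_mul_factorial (Nat.lt_succ_iff.mp (Finset.mem_range.mp h))

/-- Each binomial term contributes the same amount `π² m!`, since the factorials from the moments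
cancel those in the binomial coefficient; there are `m + 1` terms. -/
theorem gaussInt_two_norm_pow (m : ℕ) :
    gaussInt (fun z : Fin 2 → ℂ => ENNReal.ofReal ((∑ i, ‖z i‖ ^ 2) ^ m))
      = ENNReal.ofReal (π ^ 2 * (m + 1).factorial) := by
  rw [gaussInt_eq_sum (Finset.range (m + 1)) (fun i => (m.choose i : ℝ)) (fun i => ![i, m - i])
    (fun z => by positivity)]
  · congr 1
    have : ∀ i ∈ Finset.range (m + 1), (m.choose i : ℝ)
        * ∏ l : Fin 2, (π * ((![i, m - i] : Fin 2 → ℕ) l).factorial) = π ^ 2 * m.factorial := by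
      intro i hi
      rw [Fin.prod_univ_two, ← choose_mul_factorials hi]
      simp only [Matrix.cons_val]
      ring
    rw [Finset.sum_congr rfl this, Finset.sum_const, Finset.card_range, nsmul_eq_mul,
      Nat.factorial_succ]
    push_cast
    ring
  · intro z
    rw [Fin.sum_univ_two, add_pow]
    refine Finset.sum_congr rfl fun i _ => ?_
    rw [Fin.prod_univ_two]
    simp only [Matrix.cons_val]
    ring

/-- The binomial terms are again equal up to alternating sign, and `2n + 1` alternating signs sum to
`1`. Compared with `gaussInt_two_norm_pow`, the missing count `2n + 1` is the source of the
denominator in the moments of `J`. -/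
theorem gaussInt_two_sub_pow (c : ℝ) (n : ℕ) :
    gaussInt (fun z : Fin 2 → ℂ =>
        ENNReal.ofReal ((c * ‖z 0‖ ^ 2 + -c * ‖z 1‖ ^ 2) ^ (2 * n)))
      = ENNReal.ofReal (π ^ 2 * (2 * n).factorial * (c ^ 2) ^ n) := by
  rw [gaussInt_eq_sum (Finset.range (2 * n + 1))
    (fun i => c ^ (2 * n) * (-1) ^ (2 * n - i) * ((2 * n).choose i : ℝ))
    (fun i => ![i, 2 * n - i]) (fun z => by rw [pow_mul]; positivity)]
  · congr 1
    have : ∀ i ∈ Finset.range (2 * n + 1), c ^ (2 * n) * (-1) ^ (2 * n - i)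
        * ((2 * n).choose i : ℝ)
        * ∏ l : Fin 2, (π * ((![i, 2 * n - i] : Fin 2 → ℕ) l).factorial)
        = c ^ (2 * n) * π ^ 2 * (2 * n).factorial * (-1) ^ (2 * n - i) := by
      intro i hi
      rw [Fin.prod_univ_two, ← choose_mul_factorials hi]
      simp only [Matrix.cons_val]
      ring
    rw [Finset.sum_congr rfl this, ← Finset.mul_sum]
    have hs : ∑ i ∈ Finset.range (2 * n + 1), (-1 : ℝ) ^ (2 * n - i) = 1 := by
      have := Finset.sum_range_reflect (fun j => (-1 : ℝ) ^ j) (2 * n + 1)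
      simp only [Nat.add_sub_cancel] at this
      rw [this, neg_one_geom_sum, if_neg]
      rw [Nat.not_even_iff_odd]
      exact odd_two_mul_add_one n
    rw [hs, pow_mul]
    ring
  · intro z
    rw [add_pow]
    refine Finset.sum_congr rfl fun i hi => ?_
    rw [Fin.prod_univ_two]
    simp only [Matrix.cons_val]
    have h2 : c ^ (2 * n) = c ^ i * c ^ (2 * n - i) := by
      rw [← pow_add, Nat.add_sub_cancel' (Nat.lt_succ_iff.mp (Finset.mem_range.mp hi))]
    rw [h2, mul_pow, mul_pow, neg_pow]
    ring

theorem gaussInt_three_prod_pow (n : ℕ) :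
    gaussInt (fun z : Fin 3 → ℂ =>
        ENNReal.ofReal ((‖z 0‖ ^ 2 * ‖z 1‖ ^ 2 * ‖z 2‖ ^ 2) ^ n))
      = ENNReal.ofReal (π ^ 3 * (n.factorial : ℝ) ^ 3) := by
  rw [gaussInt_eq_sum {()} (fun _ => 1) (fun _ => ![n, n, n]) (fun z => by positivity)]
  · congr 1
    rw [Finset.sum_singleton, Fin.prod_univ_three]
    simp only [Matrix.cons_val]
    ring
  · intro z
    rw [Finset.sum_singleton, Fin.prod_univ_three]
    simp only [Matrix.cons_val]
    ring

theorem gaussInt_three_norm_pow (m : ℕ) :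
    gaussInt (fun z : Fin 3 → ℂ => ENNReal.ofReal ((∑ i, ‖z i‖ ^ 2) ^ m))
      = ENNReal.ofReal (π ^ 3 * (m + 2).factorial / 2) := by
  rw [gaussInt_eq_sum ((Finset.range (m + 1)).sigma fun i => Finset.range (i + 1))
    (fun j => (m.choose j.1 : ℝ) * (j.1.choose j.2 : ℝ)) (fun j => ![j.2, j.1 - j.2, m - j.1])
    (fun z => by positivity)]
  · congr 1
    rw [Finset.sum_sigma]
    have : ∀ i ∈ Finset.range (m + 1), ∑ l ∈ Finset.range (i + 1), (m.choose i : ℝ)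
        * (i.choose l : ℝ)
        * ∏ t : Fin 3, (π * ((![l, i - l, m - i] : Fin 3 → ℕ) t).factorial)
        = π ^ 3 * m.factorial * ((i : ℝ) + 1) := by
      intro i hi
      have h2 : ∀ l ∈ Finset.range (i + 1), (m.choose i : ℝ) * (i.choose l : ℝ)
          * ∏ t : Fin 3, (π * ((![l, i - l, m - i] : Fin 3 → ℕ) t).factorial)
          = π ^ 3 * m.factorial := by
        intro l hl
        rw [Fin.prod_univ_three, ← choose_mul_factorials hi, ← choose_mul_factorials hl]
        simp only [Matrix.cons_val]
        ring
      rw [Finset.sum_congr rfl h2, Finset.sum_const, Finset.card_range, nsmul_eq_mul]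
      push_cast
      ring
    rw [Finset.sum_congr rfl this, ← Finset.mul_sum]
    have hs : ∀ N : ℕ, ∑ i ∈ Finset.range N, ((i : ℝ) + 1) = N * (N + 1) / 2 := by
      intro N
      induction N with
      | zero => simp
      | succ N ih => rw [Finset.sum_range_succ, ih]; push_cast; ring
    rw [hs, Nat.factorial_succ (m + 1), Nat.factorial_succ m]
    push_cast
    ring
  · intro z
    rw [Fin.sum_univ_three, add_pow, Finset.sum_sigma]
    refine Finset.sum_congr rfl fun i _ => ?_
    rw [add_pow, Finset.sum_mul, Finset.sum_mul]
    refine Finset.sum_congr rfl fun l _ => ?_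
    rw [Fin.prod_univ_three]
    simp only [Matrix.cons_val]
    ring

/-! ### Haar averages by Gaussian integration in two orders. -/

theorem measurable_entry (i j : Fin 3) :
    Measurable fun U : U3 => (U : Matrix (Fin 3) (Fin 3) ℂ) i j := by
  have h : Continuous fun U : U3 => (U : Matrix (Fin 3) (Fin 3) ℂ) := continuous_subtype_val
  exact ((continuous_apply_apply i j).comp h).measurable

theorem lintegral_haarU3_mul_left (V : U3) (f : U3 → ℝ≥0∞) :
    ∫⁻ U, f (V * U) ∂haarU3 = ∫⁻ U, f U ∂haarU3 := by
  unfold haarU3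
  exact lintegral_mul_left_eq_self f V

/-- An orthonormal family indexed by a subset extends to the rows of a unitary matrix. -/
theorem exists_unitary_rows {s : Set (Fin 3)} (v : Fin 3 → EuclideanSpace ℂ (Fin 3))
    (hv : Orthonormal ℂ (s.domRestrict v)) :
    ∃ V : U3, ∀ i ∈ s, ∀ j, (V : Matrix (Fin 3) (Fin 3) ℂ) i j = v i j := by
  obtain ⟨b, hb⟩ := hv.exists_orthonormalBasis_extension_of_card_eq (by simp)
  refine ⟨⟨Matrix.of fun i j => b i j, ?_⟩, fun i hi j => by simp [hb i hi]⟩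
  rw [Matrix.mem_unitaryGroup_iff]
  ext i k
  have h := orthonormal_iff_ite.mp b.orthonormal k i
  rw [PiLp.inner_apply] at h
  rw [Matrix.mul_apply, Matrix.one_apply]
  simp only [Matrix.of_apply, Matrix.star_apply]
  simp only [RCLike.inner_apply] at h
  rw [show (if i = k then (1 : ℂ) else 0) = if k = i then 1 else 0 by simp [eq_comm], ← h]
  rfl

theorem exists_smul_unit {d : ℕ} (z : Fin (d + 1) → ℂ) :
    ∃ v : Fin (d + 1) → ℂ, ∑ i, ‖v i‖ ^ 2 = 1
      ∧ ∀ i, z i = ((√(∑ i, ‖z i‖ ^ 2) : ℝ) : ℂ) * v i := by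
  rcases eq_or_lt_of_le (Finset.sum_nonneg fun i (_ : i ∈ Finset.univ) => sq_nonneg ‖z i‖)
    with h | h
  -- At `z = 0` any unit vector will do.
  · refine ⟨Pi.single 0 1, ?_, fun i => ?_⟩
    · rw [Finset.sum_eq_single 0]
      · simp
      · intro i _ hi
        simp [Pi.single_eq_of_ne hi]
      · simp
    · have := (Finset.sum_eq_zero_iff_of_nonneg fun i _ => sq_nonneg ‖z i‖).mp h.symm i
        (Finset.mem_univ i)
      rw [← h, sqrt_zero, Complex.ofReal_zero, zero_mul]
      simpa using this
  · set r := √(∑ i, ‖z i‖ ^ 2) with hr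
    have hr0 : 0 < r := sqrt_pos.mpr h
    have hrc : (r : ℂ) ≠ 0 := by exact_mod_cast hr0.ne'
    refine ⟨fun i => z i / r, ?_, fun i => by field_simp⟩
    simp only [norm_div, Complex.norm_real, norm_eq_abs, div_pow, sq_abs]
    rw [← Finset.sum_div, hr, sq_sqrt h.le, div_self h.ne']

theorem orthonormal_of_inner {s : Set (Fin 3)} {v : Fin 3 → EuclideanSpace ℂ (Fin 3)}
    (h1 : ∀ i ∈ s, ∑ l, ‖v i l‖ ^ 2 = 1) (h2 : ∀ i ∈ s, ∀ j ∈ s, i ≠ j → inner ℂ (v i) (v j) = 0) :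
    Orthonormal ℂ (s.domRestrict v) := by
  refine ⟨fun i => ?_, fun i j hij => h2 i i.2 j j.2 fun h => hij (Subtype.ext h)⟩
  rw [Set.domRestrict_apply, EuclideanSpace.norm_eq, h1 i i.2, sqrt_one]

theorem mul_apply_three (V U : U3) (i j : Fin 3) :
    ((V * U : U3) : Matrix (Fin 3) (Fin 3) ℂ) i j
      = (V : Matrix (Fin 3) (Fin 3) ℂ) i 0 * (U : Matrix (Fin 3) (Fin 3) ℂ) 0 j
        + (V : Matrix (Fin 3) (Fin 3) ℂ) i 1 * (U : Matrix (Fin 3) (Fin 3) ℂ) 1 j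
        + (V : Matrix (Fin 3) (Fin 3) ℂ) i 2 * (U : Matrix (Fin 3) (Fin 3) ℂ) 2 j := by
  show ((V : Matrix (Fin 3) (Fin 3) ℂ) * (U : Matrix (Fin 3) (Fin 3) ℂ)) i j = _
  rw [Matrix.mul_apply, Fin.sum_univ_three]

/-- The product of the squared moduli of the entries of the first row. -/
noncomputable def rowProd (U : U3) : ℝ :=
  ‖(U : Matrix (Fin 3) (Fin 3) ℂ) 0 0‖ ^ 2 * ‖(U : Matrix (Fin 3) (Fin 3) ℂ) 0 1‖ ^ 2
    * ‖(U : Matrix (Fin 3) (Fin 3) ℂ) 0 2‖ ^ 2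

/-- Write `z = r v` with `v` a unit vector and complete `v` to a unitary matrix `V` with first row
`v`. Then `z U` is `r` times the first row of `V U`, and left invariance removes `V`. -/
theorem lintegral_vecMul_prod_pow (n : ℕ) (z : Fin 3 → ℂ) :
    ∫⁻ U : U3, ENNReal.ofReal ((‖(z ᵥ* (U : Matrix (Fin 3) (Fin 3) ℂ)) 0‖ ^ 2
        * ‖(z ᵥ* (U : Matrix (Fin 3) (Fin 3) ℂ)) 1‖ ^ 2
        * ‖(z ᵥ* (U : Matrix (Fin 3) (Fin 3) ℂ)) 2‖ ^ 2) ^ n) ∂haarU3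
      = ENNReal.ofReal ((∑ i, ‖z i‖ ^ 2) ^ (3 * n))
        * ∫⁻ U, ENNReal.ofReal (rowProd U ^ n) ∂haarU3 := by
  obtain ⟨v, hv1, hv⟩ := exists_smul_unit z
  set r := √(∑ i, ‖z i‖ ^ 2) with hr
  have hr2 : r ^ 2 = ∑ i, ‖z i‖ ^ 2 := sq_sqrt (Finset.sum_nonneg fun i _ => sq_nonneg _)
  obtain ⟨V, hV⟩ := exists_unitary_rows (s := {0}) (fun _ => WithLp.toLp 2 v)
    (orthonormal_of_inner (fun i _ => hv1) fun i hi j hj hij => absurd (hi.trans hj.symm) hij)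
  have e : ∀ (U : U3) (j : Fin 3), ‖(z ᵥ* (U : Matrix (Fin 3) (Fin 3) ℂ)) j‖ ^ 2
      = r ^ 2 * ‖((V * U : U3) : Matrix (Fin 3) (Fin 3) ℂ) 0 j‖ ^ 2 := by
    intro U j
    rw [mul_apply_three, hV 0 rfl, hV 0 rfl, hV 0 rfl, Matrix.vecMul, dotProduct,
      Fin.sum_univ_three, hv 0, hv 1, hv 2, mul_assoc, mul_assoc, mul_assoc, ← mul_add, ← mul_add,
      norm_mul, mul_pow, Complex.norm_real, norm_eq_abs, sq_abs]
  rw [← lintegral_haarU3_mul_left V fun U => ENNReal.ofReal (rowProd U ^ n),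
    ← lintegral_const_mul' _ _ ENNReal.ofReal_ne_top]
  refine lintegral_congr fun U => ?_
  rw [e, e, e, ← ENNReal.ofReal_mul (by positivity), ← hr2, rowProd]
  congr 1
  ring

theorem eq_ofReal_div {a b : ℝ} (ha : 0 < a) {X : ℝ≥0∞}
    (h : ENNReal.ofReal a * X = ENNReal.ofReal b) : X = ENNReal.ofReal (b / a) := by
  rw [ENNReal.ofReal_div_of_pos ha, ← h, mul_comm, ENNReal.mul_div_cancel_right
    (ENNReal.ofReal_pos.mpr ha).ne' ENNReal.ofReal_ne_top]

/-- Integrate the product for `z U` over Gaussian `z` and Haar `U`. Unitary invariance of the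
Gaussian removes `U` in one order; invariance of Haar measure factors out a power of the norm in the
other. -/
theorem lintegral_rowProd_pow (n : ℕ) :
    ∫⁻ U, ENNReal.ofReal (rowProd U ^ n) ∂haarU3
      = ENNReal.ofReal (2 * (n.factorial : ℝ) ^ 3 / (3 * n + 2).factorial) := by
  set F : (Fin 3 → ℂ) → ℝ≥0∞ := fun z =>
    ENNReal.ofReal ((‖z 0‖ ^ 2 * ‖z 1‖ ^ 2 * ‖z 2‖ ^ 2) ^ n) with hF
  have hFm : Measurable F := by fun_prop
  have hpi := pi_pos
  have h1 : ∫⁻ U : U3, gaussInt (fun z => F (z ᵥ* (U : Matrix (Fin 3) (Fin 3) ℂ))) ∂haarU3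
      = ENNReal.ofReal (π ^ 3 * (n.factorial : ℝ) ^ 3) := by
    simp_rw [fun U : U3 => gaussInt_vecMul_unitary U.2 hFm]
    rw [lintegral_const, measure_univ, mul_one, gaussInt_three_prod_pow]
  have hmeas : Measurable (Function.uncurry fun (U : U3) (z : Fin 3 → ℂ) =>
      ENNReal.ofReal (rexp (-∑ i, ‖z i‖ ^ 2)) * F (z ᵥ* (U : Matrix (Fin 3) (Fin 3) ℂ))) := by
    refine Measurable.mul (by fun_prop) (hFm.comp (measurable_pi_lambda _ fun j => ?_))
    simp only [Matrix.vecMul, dotProduct]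
    refine Finset.measurable_sum _ fun i _ => ?_
    exact ((measurable_pi_apply i).comp measurable_snd).mul
      ((measurable_entry i j).comp measurable_fst)
  unfold gaussInt at h1
  rw [lintegral_lintegral_swap hmeas.aemeasurable] at h1
  simp_rw [lintegral_const_mul' _ _ ENNReal.ofReal_ne_top, hF, lintegral_vecMul_prod_pow,
    ← mul_assoc] at h1
  rw [lintegral_mul_const _ (by fun_prop)] at h1
  have h2 := gaussInt_three_norm_pow (3 * n)
  unfold gaussInt at h2
  rw [h2] at h1
  rw [eq_ofReal_div (by positivity) h1]
  congr 1
  field_simp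

/-- The Jarlskog invariant with the second row replaced by a combination of the last two rows. -/
noncomputable def mixJ (U : U3) (z : Fin 2 → ℂ) : ℝ :=
  ((U : Matrix (Fin 3) (Fin 3) ℂ) 0 0
    * (z 0 * (U : Matrix (Fin 3) (Fin 3) ℂ) 1 1 + z 1 * (U : Matrix (Fin 3) (Fin 3) ℂ) 2 1)
    * star ((U : Matrix (Fin 3) (Fin 3) ℂ) 0 1)
    * star (z 0 * (U : Matrix (Fin 3) (Fin 3) ℂ) 1 0
      + z 1 * (U : Matrix (Fin 3) (Fin 3) ℂ) 2 0)).im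

theorem lintegral_mixJ_pow (n : ℕ) (z : Fin 2 → ℂ) :
    ∫⁻ U, ENNReal.ofReal (mixJ U z ^ (2 * n)) ∂haarU3
      = ENNReal.ofReal ((∑ i, ‖z i‖ ^ 2) ^ (2 * n))
        * ∫⁻ U, ENNReal.ofReal (J U ^ (2 * n)) ∂haarU3 := by
  obtain ⟨v, hv1, hv⟩ := exists_smul_unit z
  set r := √(∑ i, ‖z i‖ ^ 2) with hr
  have hr2 : r ^ 2 = ∑ i, ‖z i‖ ^ 2 := sq_sqrt (Finset.sum_nonneg fun i _ => sq_nonneg _)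
  rw [Fin.sum_univ_two] at hv1
  obtain ⟨V, hV⟩ := exists_unitary_rows (s := {0, 1})
    ![WithLp.toLp 2 ![1, 0, 0], WithLp.toLp 2 ![0, v 0, v 1], 0]
    (orthonormal_of_inner (by
      rintro i (rfl | rfl)
      · simp [Fin.sum_univ_three]
      · simpa [Fin.sum_univ_three] using hv1) (by
      rintro i (rfl | rfl) j (rfl | rfl) hij
      · exact absurd rfl hij
      · simp [PiLp.inner_apply, Fin.sum_univ_three]
      · simp [PiLp.inner_apply, Fin.sum_univ_three]
      · exact absurd rfl hij))
  have e : ∀ U : U3, mixJ U z = r ^ 2 * J (V * U) := by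
    intro U
    have h0 : ∀ j, ((V * U : U3) : Matrix (Fin 3) (Fin 3) ℂ) 0 j
        = (U : Matrix (Fin 3) (Fin 3) ℂ) 0 j := by
      intro j
      rw [mul_apply_three, hV 0 (by simp), hV 0 (by simp), hV 0 (by simp)]
      simp
    have h1 : ∀ j, ((V * U : U3) : Matrix (Fin 3) (Fin 3) ℂ) 1 j
        = v 0 * (U : Matrix (Fin 3) (Fin 3) ℂ) 1 j + v 1 * (U : Matrix (Fin 3) (Fin 3) ℂ) 2 j := by
      intro j
      rw [mul_apply_three, hV 1 (by simp), hV 1 (by simp), hV 1 (by simp)]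
      simp
    rw [J, h0, h0, h1, h1, mixJ, hv 0, hv 1, ← Complex.im_ofReal_mul]
    congr 1
    simp only [star_add, star_mul', Complex.star_def, Complex.conj_ofReal]
    push_cast
    ring
  rw [← lintegral_haarU3_mul_left V fun U => ENNReal.ofReal (J U ^ (2 * n)),
    ← lintegral_const_mul' _ _ ENNReal.ofReal_ne_top]
  refine lintegral_congr fun U => ?_
  rw [e, ← ENNReal.ofReal_mul (by positivity), ← hr2, mul_pow]

/-- For a unitary matrix the adjugate is the determinant times the adjoint, and the determinant has
modulus one. -/
theorem norm_sq_minor (U : U3) :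
    ‖(U : Matrix (Fin 3) (Fin 3) ℂ) 1 0 * (U : Matrix (Fin 3) (Fin 3) ℂ) 2 1
      - (U : Matrix (Fin 3) (Fin 3) ℂ) 1 1 * (U : Matrix (Fin 3) (Fin 3) ℂ) 2 0‖ ^ 2
      = ‖(U : Matrix (Fin 3) (Fin 3) ℂ) 0 2‖ ^ 2 := by
  have hU := Matrix.mem_unitaryGroup_iff.mp U.2
  have hdet := congrArg Matrix.det hU
  rw [Matrix.det_mul, Matrix.star_eq_conjTranspose, Matrix.det_conjTranspose, Matrix.det_one,
    Complex.star_def, Complex.mul_conj, Complex.normSq_eq_norm_sq] at hdet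
  generalize (U : Matrix (Fin 3) (Fin 3) ℂ) = W at *
  have hadj : W.adjugate = W.det • star W := by
    calc W.adjugate = W.adjugate * (W * star W) := by rw [hU, mul_one]
      _ = W.det • star W := by rw [← mul_assoc, Matrix.adjugate_mul, Matrix.smul_mul, one_mul]
  have h := congrFun (congrFun hadj 2) 0
  rw [Matrix.adjugate_fin_three] at h
  simp only [Matrix.of_apply, Matrix.cons_val, Matrix.smul_apply, Matrix.star_apply,
    smul_eq_mul] at h
  have hd : ‖W.det‖ ^ 2 = 1 := by exact_mod_cast hdet
  rw [h, norm_mul, mul_pow, hd, one_mul, norm_star]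

theorem column_orthogonal (U : U3) :
    star ((U : Matrix (Fin 3) (Fin 3) ℂ) 0 0) * (U : Matrix (Fin 3) (Fin 3) ℂ) 0 1
      + star ((U : Matrix (Fin 3) (Fin 3) ℂ) 1 0) * (U : Matrix (Fin 3) (Fin 3) ℂ) 1 1
      + star ((U : Matrix (Fin 3) (Fin 3) ℂ) 2 0) * (U : Matrix (Fin 3) (Fin 3) ℂ) 2 1 = 0 := by
  have h := congrFun (congrFun (Matrix.mem_unitaryGroup_iff'.mp U.2) 0) 1
  rw [Matrix.mul_apply, Fin.sum_univ_three, Matrix.one_apply_ne (by decide)] at h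
  exact h

/-- A Hermitian form is a combination of the squared moduli of unitary coordinates. -/
theorem vecMul_dotProduct_star_eq {A : Matrix (Fin 2) (Fin 2) ℂ} (hA : A.IsHermitian)
    (z : Fin 2 → ℂ) :
    (z ᵥ* A) ⬝ᵥ star z
      = ((hA.eigenvalues 0 * ‖(z ᵥ* (hA.eigenvectorUnitary : Matrix (Fin 2) (Fin 2) ℂ)) 0‖ ^ 2
        + hA.eigenvalues 1 * ‖(z ᵥ* (hA.eigenvectorUnitary : Matrix (Fin 2) (Fin 2) ℂ)) 1‖ ^ 2 :
          ℝ) : ℂ) := by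
  have h := hA.spectral_theorem
  rw [Unitary.conjStarAlgAut_apply] at h
  set V := (hA.eigenvectorUnitary : Matrix (Fin 2) (Fin 2) ℂ)
  set e := hA.eigenvalues
  have h1 : (z ᵥ* A) ⬝ᵥ star z
      = ((z ᵥ* V) ᵥ* Matrix.diagonal (RCLike.ofReal ∘ e)) ⬝ᵥ star (z ᵥ* V) := by
    conv_lhs => rw [h]
    rw [Matrix.star_vecMul, ← Matrix.star_eq_conjTranspose, ← Matrix.vecMul_vecMul,
      ← Matrix.vecMul_vecMul, Matrix.dotProduct_mulVec]
  rw [h1, dotProduct, Fin.sum_univ_two, Matrix.vecMul_diagonal, Matrix.vecMul_diagonal]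
  simp only [Function.comp_apply, Pi.star_apply, Complex.coe_algebraMap]
  rw [mul_right_comm, mul_right_comm _ _ (star _), Complex.star_def, Complex.mul_conj,
    Complex.mul_conj, Complex.normSq_eq_norm_sq, Complex.normSq_eq_norm_sq]
  push_cast
  ring

/-- For a fixed unitary matrix the mixed invariant is a traceless Hermitian form. -/
theorem exists_diagonalization_mixJ (U : U3) :
    ∃ V ∈ Matrix.unitaryGroup (Fin 2) ℂ, ∃ l : ℝ, l ^ 2 = rowProd U / 4
      ∧ ∀ z : Fin 2 → ℂ, mixJ U z = l * ‖(z ᵥ* V) 0‖ ^ 2 + -l * ‖(z ᵥ* V) 1‖ ^ 2 := by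
  have hmin := norm_sq_minor U
  have hcol := column_orthogonal U
  have hcol' := congrArg star hcol
  simp only [star_add, star_mul', star_star, star_zero] at hcol'
  unfold mixJ rowProd
  generalize (U : Matrix (Fin 3) (Fin 3) ℂ) = W at *
  -- Chosen so that `Im x = -(I/2) x + (I/2) star x` makes the invariant equal to `w1 * q * star w0`
  -- plus its conjugate, with `w0, w1` the first two entries of the mixed row. This is the form of
  -- `H` pulled back by `N`.
  set q : ℂ := -(Complex.I / 2) * (W 0 0 * star (W 0 1)) with hq
  have hqs : star q = Complex.I / 2 * (star (W 0 0) * W 0 1) := by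
    rw [hq, star_mul', star_mul', star_star, star_neg, Complex.star_def, map_div₀, Complex.conj_I,
      map_ofNat]
    ring
  set N : Matrix (Fin 2) (Fin 2) ℂ := !![W 1 0, W 1 1; W 2 0, W 2 1] with hN
  set H : Matrix (Fin 2) (Fin 2) ℂ := !![0, star q; q, 0] with hH
  have hHh : H.IsHermitian := by
    ext i j
    fin_cases i <;> fin_cases j <;> simp [hH]
  have hA : (N * H * Nᴴ).IsHermitian := Matrix.isHermitian_mul_mul_conjTranspose N hHh
  -- Orthogonality of the first two columns replaces the sum over the last two rows by the first-row
  -- term, leaving a purely imaginary number plus its conjugate.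
  have htr : (N * H * Nᴴ).trace = 0 := by
    rw [Matrix.trace_fin_two]
    simp only [Matrix.mul_apply, Fin.sum_univ_two, Matrix.conjTranspose_apply, hN, hH,
      Matrix.of_apply, Matrix.cons_val, mul_zero, zero_add, add_zero]
    rw [hqs, hq]
    linear_combination (-(Complex.I / 2) * (W 0 0 * star (W 0 1))) * hcol
      + (Complex.I / 2 * (star (W 0 0) * W 0 1)) * hcol'
  -- The determinant is `-‖q‖² ‖det N‖²`, and the minor `det N` has the modulus of the entry `W 0
  -- 2`. With trace zero this fixes the eigenvalues up to sign.
  have hdet : (N * H * Nᴴ).det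
      = ((-(‖W 0 0‖ ^ 2 * ‖W 0 1‖ ^ 2 * ‖W 0 2‖ ^ 2 / 4) : ℝ) : ℂ) := by
    have hNd : N.det = W 1 0 * W 2 1 - W 1 1 * W 2 0 := by simp [hN, Matrix.det_fin_two]
    have hHd : H.det = -((‖q‖ ^ 2 : ℝ) : ℂ) := by
      rw [hH, Matrix.det_fin_two_of, mul_zero, zero_sub, mul_comm, Complex.star_def,
        Complex.mul_conj, Complex.normSq_eq_norm_sq]
    have hqn : ‖q‖ ^ 2 = ‖W 0 0‖ ^ 2 * ‖W 0 1‖ ^ 2 / 4 := by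
      rw [hq, norm_mul, norm_mul, norm_neg, norm_div, Complex.norm_I, norm_star]
      norm_num
      ring
    rw [Matrix.det_mul, Matrix.det_mul, Matrix.det_conjTranspose, mul_right_comm, Complex.star_def,
      Complex.mul_conj, Complex.normSq_eq_norm_sq, hHd, hNd, hmin, hqn]
    push_cast
    ring
  have e1 := hA.trace_eq_sum_eigenvalues
  have e2 := hA.det_eq_prod_eigenvalues
  rw [htr, Fin.sum_univ_two] at e1
  rw [hdet, Fin.prod_univ_two] at e2
  have e1' : hA.eigenvalues 1 = -hA.eigenvalues 0 := by
    have : (0 : ℝ) = hA.eigenvalues 0 + hA.eigenvalues 1 := by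
      apply Complex.ofReal_injective
      rw [Complex.ofReal_zero, Complex.ofReal_add]
      exact e1
    linarith
  have e2' : -(‖W 0 0‖ ^ 2 * ‖W 0 1‖ ^ 2 * ‖W 0 2‖ ^ 2 / 4)
      = hA.eigenvalues 0 * hA.eigenvalues 1 := by
    apply Complex.ofReal_injective
    rw [Complex.ofReal_mul]
    exact e2
  refine ⟨hA.eigenvectorUnitary, hA.eigenvectorUnitary.2, hA.eigenvalues 0, ?_, fun z => ?_⟩
  · rw [e1'] at e2'
    linarith
  · have h := vecMul_dotProduct_star_eq hA z
    rw [e1'] at h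
    rw [← Complex.ofReal_inj, ← h]
    set w0 := z 0 * W 1 0 + z 1 * W 2 0 with hw0
    set w1 := z 0 * W 1 1 + z 1 * W 2 1 with hw1
    have hform : (z ᵥ* (N * H * Nᴴ)) ⬝ᵥ star z = w1 * q * star w0 + w0 * star q * star w1 := by
      have hzN : z ᵥ* N = ![w0, w1] := by
        ext i
        fin_cases i <;> simp [Matrix.vecMul, dotProduct, hN, hw0, hw1, Fin.sum_univ_two]
      rw [← Matrix.vecMul_vecMul, ← Matrix.dotProduct_mulVec, ← Matrix.star_vecMul,
        ← Matrix.vecMul_vecMul, hzN]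
      simp [Matrix.vecMul, dotProduct, hH, Fin.sum_univ_two]
    rw [hform]
    have him : ∀ x : ℂ, ((x.im : ℝ) : ℂ) = -(Complex.I / 2) * x + Complex.I / 2 * star x := by
      intro x
      apply Complex.ext
      · simp; ring
      · simp
    rw [him, hqs, hq]
    simp only [star_mul', star_star]
    ring

theorem measurable_mixJ : Measurable (Function.uncurry mixJ) := by
  have h : ∀ i j, Measurable fun p : U3 × (Fin 2 → ℂ) => (p.1 : Matrix (Fin 3) (Fin 3) ℂ) i j :=
    fun i j => (measurable_entry i j).comp measurable_fst
  have hz : ∀ i, Measurable fun p : U3 × (Fin 2 → ℂ) => p.2 i :=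
    fun i => (measurable_pi_apply i).comp measurable_snd
  refine Complex.measurable_im.comp ?_
  exact (((h 0 0).mul (((hz 0).mul (h 1 1)).add ((hz 1).mul (h 2 1)))).mul
    (continuous_star.measurable.comp (h 0 1))).mul
    (continuous_star.measurable.comp (((hz 0).mul (h 1 0)).add ((hz 1).mul (h 2 0))))

theorem gaussInt_mixJ_pow (U : U3) (n : ℕ) :
    gaussInt (fun z => ENNReal.ofReal (mixJ U z ^ (2 * n)))
      = ENNReal.ofReal (π ^ 2 * (2 * n).factorial * (1 / 4) ^ n)
        * ENNReal.ofReal (rowProd U ^ n) := by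
  obtain ⟨V, hV, l, hl, h⟩ := exists_diagonalization_mixJ U
  have hpi := pi_pos
  simp_rw [h]
  rw [gaussInt_vecMul_unitary hV (f := fun z => ENNReal.ofReal
    ((l * ‖z 0‖ ^ 2 + -l * ‖z 1‖ ^ 2) ^ (2 * n))) (by fun_prop), gaussInt_two_sub_pow, hl,
    ← ENNReal.ofReal_mul (by positivity)]
  congr 1
  rw [div_pow, one_div_pow]
  ring

/-- The even moments of the Jarlskog invariant under Haar measure. -/
theorem lintegral_J_pow (n : ℕ) :
    ∫⁻ U, ENNReal.ofReal (J U ^ (2 * n)) ∂haarU3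
      = ENNReal.ofReal ((1 / 4) ^ n * (2 * (n.factorial : ℝ) ^ 3 / (3 * n + 2).factorial)
        / (2 * n + 1)) := by
  have hpi := pi_pos
  have h1 : ∫⁻ U : U3, gaussInt (fun z => ENNReal.ofReal (mixJ U z ^ (2 * n))) ∂haarU3
      = ENNReal.ofReal (π ^ 2 * (2 * n).factorial * (1 / 4) ^ n
        * (2 * (n.factorial : ℝ) ^ 3 / (3 * n + 2).factorial)) := by
    simp_rw [gaussInt_mixJ_pow]
    rw [lintegral_const_mul' _ _ ENNReal.ofReal_ne_top, lintegral_rowProd_pow,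
      ← ENNReal.ofReal_mul (by positivity)]
  have hmeas : Measurable (Function.uncurry fun (U : U3) (z : Fin 2 → ℂ) =>
      ENNReal.ofReal (rexp (-∑ i, ‖z i‖ ^ 2)) * ENNReal.ofReal (mixJ U z ^ (2 * n))) :=
    Measurable.mul (by fun_prop) (ENNReal.measurable_ofReal.comp (measurable_mixJ.pow_const _))
  unfold gaussInt at h1
  rw [lintegral_lintegral_swap hmeas.aemeasurable] at h1
  simp_rw [lintegral_const_mul' _ _ ENNReal.ofReal_ne_top, lintegral_mixJ_pow, ← mul_assoc] at h1
  rw [lintegral_mul_const _ (by fun_prop)] at h1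
  have h2 := gaussInt_two_norm_pow (2 * n)
  unfold gaussInt at h2
  rw [h2] at h1
  rw [eq_ofReal_div (by positivity) h1, Nat.factorial_succ (2 * n)]
  congr 1
  push_cast
  field_simp

/-! ### Comparison of Haar measure with `μ_1`. -/

theorem measurable_J : Measurable J := by
  refine Complex.measurable_im.comp ?_
  exact (((measurable_entry 0 0).mul (measurable_entry 1 1)).mul
    (continuous_star.measurable.comp (measurable_entry 0 1))).mul
    (continuous_star.measurable.comp (measurable_entry 1 0))

theorem measurable_absJ : Measurable absJ :=
  (continuous_Q.measurable.sqrt).div_const 2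

theorem absJ_sq {b : Fin 4 → ℝ} (hb : 0 ≤ Q b) : absJ b ^ 2 = Q b / 4 := by
  rw [absJ, div_pow, sq_sqrt hb]
  norm_num

theorem abs_J_le_one (U : U3) : |J U| ≤ 1 := by
  have h : ∀ i j, ‖(U : Matrix (Fin 3) (Fin 3) ℂ) i j‖ ≤ 1 :=
    fun i j => entry_norm_bound_of_unitary U.2 i j
  refine (Complex.abs_im_le_norm _).trans ?_
  rw [norm_mul, norm_mul, norm_mul, norm_star, norm_star]
  exact mul_le_one₀ (mul_le_one₀ (mul_le_one₀ (h 0 0) (norm_nonneg _) (h 1 1)) (norm_nonneg _)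
    (h 0 1)) (norm_nonneg _) (h 1 0)

theorem ae_mu_one : ∀ᵐ b ∂(mu 1), absJ b ^ 2 ∈ Icc (0 : ℝ) 1 := by
  have h0 : rawMu 1 (Q ⁻¹' Ioi 1) = 0 := by
    have hQm : MeasurableSet (Q ⁻¹' Ioi 1) := continuous_Q.measurable measurableSet_Ioi
    have h1 : (volume.restrict Omega) (Q ⁻¹' Ioi 1) = 0 := by
      rw [← lintegral_indicator_one hQm]
      change ∫⁻ b in Omega, (Ioi (1 : ℝ)).indicator 1 (Q b) = 0
      rw [lintegral_Omega (measurable_one.indicator measurableSet_Ioi)]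
      refine (setLIntegral_congr_fun measurableSet_simplex (g := fun _ => 0) fun a ha => ?_).trans
        lintegral_zero
      have hle := bary_le ha
      have hpos := bary_pos ha
      have : ∀ t ∈ Ioc (0 : ℝ) 1, (Ioi (1 : ℝ)).indicator (1 : ℝ → ℝ≥0∞) (bary a * t) = 0 := by
        intro t ht
        refine indicator_of_notMem ?_ _
        rw [mem_Ioi, not_lt]
        nlinarith [ht.1, ht.2]
      rw [setLIntegral_congr_fun measurableSet_Ioc this, lintegral_zero, mul_zero]
    exact withDensity_absolutelyContinuous _ _ h1
  have h2 : ∀ᵐ b ∂(rawMu 1), Q b ≤ 1 := by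
    rw [ae_iff]
    simp only [not_le]
    exact h0
  refine Measure.ae_smul_measure ?_ _
  filter_upwards [h2] with b hb
  refine ⟨sq_nonneg _, pow_le_one₀ (by unfold absJ; positivity) ?_⟩
  have : √(Q b) ≤ 1 := sqrt_le_iff.mpr ⟨zero_le_one, by simpa using hb⟩
  unfold absJ
  linarith

/-- Multiplying the density by `Q ^ n` shifts the parameter from `1` to `n + 1`, so the moment is
`4⁻ⁿ` times a ratio of normalising constants. -/
theorem lintegral_absJ_pow (n : ℕ) :
    ∫⁻ b, ENNReal.ofReal ((absJ b ^ 2) ^ n) ∂(mu 1)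
      = ENNReal.ofReal ((1 / 4) ^ n * (2 * (n.factorial : ℝ) ^ 3 / (3 * n + 2).factorial)
        / (2 * n + 1)) := by
  have hk : (1 : ℝ) / 2 < 1 := by norm_num
  have hk2 : (1 : ℝ) / 2 < n + 1 := by linarith [(n.cast_nonneg : (0 : ℝ) ≤ n)]
  have hm : Measurable fun b => ENNReal.ofReal ((absJ b ^ 2) ^ n) :=
    ENNReal.measurable_ofReal.comp ((measurable_absJ.pow_const 2).pow_const n)
  have e : ∀ b ∈ Omega, ENNReal.ofReal (Q b ^ ((1 : ℝ) - 3 / 2)) * ENNReal.ofReal ((absJ b ^ 2) ^ n)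
      = ENNReal.ofReal ((1 / 4) ^ n) * ENNReal.ofReal (Q b ^ ((n : ℝ) + 1 - 3 / 2)) := by
    intro b hb
    have hQ : 0 ≤ Q b := hb.2.2.2
    rw [absJ_sq hQ, ← ENNReal.ofReal_mul (rpow_nonneg hQ _), ← ENNReal.ofReal_mul (by positivity)]
    congr 1
    -- At `Q b = 0` both sides vanish: the exponents `-1/2` and `n - 1/2` are never zero, and `0` to
    -- a nonzero real power is `0`.
    rcases eq_or_lt_of_le hQ with h0 | h0
    · have hne : (n : ℝ) + 1 - 3 / 2 ≠ 0 := by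
        intro h
        have h2 : 2 * n = 1 := by exact_mod_cast (by linarith : (2 : ℝ) * n = 1)
        omega
      rw [← h0, zero_rpow hne, zero_rpow (by norm_num)]
      ring
    · rw [show (n : ℝ) + 1 - 3 / 2 = (1 - 3 / 2) + n by ring, rpow_add h0, rpow_natCast, div_pow,
        one_div_pow]
      ring
  rw [mu, lintegral_smul_measure, lintegral_rawMu hm, setLIntegral_congr_fun measurableSet_Omega e,
    lintegral_const_mul' _ _ ENNReal.ofReal_ne_top, lintegral_Omega_rpow hk2, rawMu_univ hk,
    smul_eq_mul, ← ENNReal.ofReal_inv_of_pos (normConst_pos hk), ← ENNReal.ofReal_mul (by positivity),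
    ← ENNReal.ofReal_mul (inv_nonneg.mpr (normConst_pos hk).le)]
  congr 1
  have h3 : Gamma (3 * ((n : ℝ) + 1)) = (3 * n + 2).factorial := by
    rw [← Gamma_nat_eq_factorial]
    push_cast
    ring_nf
  have h4 : Gamma (3 * 1) = 2 := by
    rw [mul_one, Gamma_ofNat_eq_factorial]; norm_num [Nat.factorial]
  have hpi := pi_pos.ne'
  rw [normConst, normConst, h3, h4, Gamma_nat_eq_factorial, Gamma_one,
    show 2 * ((n : ℝ) + 1) - 1 = 2 * n + 1 by ring]
  field_simp
  norm_num

/-- The squared Jarlskog invariant has the same distribution under Haar measure and under the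
measure with parameter one. -/
theorem map_J_sq : haarU3.map (fun U => J U ^ 2) = (mu 1).map fun b => absJ b ^ 2 := by
  have hk : (1 : ℝ) / 2 < 1 := by norm_num
  have := isProbabilityMeasure_mu hk
  have hJ : Measurable fun U => J U ^ 2 := measurable_J.pow_const 2
  have hA : Measurable fun b => absJ b ^ 2 := measurable_absJ.pow_const 2
  refine ext_of_moments ?_ ?_ fun n => ?_
  · rw [ae_map_iff hJ.aemeasurable (p := (· ∈ Icc (0 : ℝ) 1)) measurableSet_Icc]
    refine ae_of_all _ fun U => ⟨sq_nonneg _, ?_⟩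
    rw [← sq_abs]
    exact pow_le_one₀ (abs_nonneg _) (abs_J_le_one U)
  · rw [ae_map_iff hA.aemeasurable (p := (· ∈ Icc (0 : ℝ) 1)) measurableSet_Icc]
    exact ae_mu_one
  · rw [lintegral_map (by fun_prop) hJ, lintegral_map (by fun_prop) hA, lintegral_absJ_pow,
      ← lintegral_J_pow]
    simp_rw [pow_mul]

theorem haarU3_real_abs_J_le {y : ℝ} (hy : 0 < y) :
    haarU3.real {U | |J U| ≤ y} = (mu 1).real {b | absJ b ≤ y} := by
  have hJ : Measurable fun U => J U ^ 2 := measurable_J.pow_const 2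
  have hA : Measurable fun b => absJ b ^ 2 := measurable_absJ.pow_const 2
  have h := congrArg (fun ρ => ρ (Iic (y ^ 2))) map_J_sq
  simp only [Measure.map_apply hJ measurableSet_Iic, Measure.map_apply hA measurableSet_Iic] at h
  have e1 : {U | |J U| ≤ y} = (fun U => J U ^ 2) ⁻¹' Iic (y ^ 2) := by
    ext U
    show |J U| ≤ y ↔ J U ^ 2 ≤ y ^ 2
    rw [sq_le_sq, abs_of_pos hy]
  have e2 : {b | absJ b ≤ y} = (fun b => absJ b ^ 2) ⁻¹' Iic (y ^ 2) := by
    ext b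
    have h0 : 0 ≤ absJ b := by unfold absJ; positivity
    exact (pow_le_pow_iff_left₀ h0 hy.le two_ne_zero).symm
  rw [measureReal_def, measureReal_def, e1, e2, h]

end Jarlskog

theorem mainTheorem7 :
    -- the distribution of `6√3 |J|` under `μ_k`, for every `k > 1/2`
    (∀ k : ℝ, 1 / 2 < k →
      IsProbabilityMeasure (Jarlskog.mu k) ∧
      ∀ x : ℝ, 0 < x → x ≤ 1 →
        Summable (Jarlskog.cdfTerm k x) ∧
        (Jarlskog.mu k).real {b | 6 * √3 * Jarlskog.absJ b ≤ x} = Jarlskog.cdf k x ∧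
        (Jarlskog.mu k).real {b | 6 * √3 * Jarlskog.absJ b < x} = Jarlskog.cdf k x) ∧
    -- the Haar measure on `U(3)`, equivalently `k = 1`
    (∃ a d : ℕ → ℝ, a 0 = 1 ∧ a 1 = 4 ∧ a 2 = 96 ∧
      d 0 = -72 ∧ d 1 = 128 ∧ d 2 = 24384 / 5 ∧
      ∀ y : ℝ, 0 < y → y ≤ 1 / (6 * √3) →
        Summable (fun n : ℕ => a n * y ^ (2 * n + 2)) ∧
        Summable (fun n : ℕ => d n * y ^ (2 * n + 2)) ∧
        Jarlskog.haarU3.real {U | |Jarlskog.J U| ≤ y} =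
          8 * Real.pi * y
            + 24 * Real.log (4 * y ^ 2) * ∑' n : ℕ, a n * y ^ (2 * n + 2)
            + ∑' n : ℕ, d n * y ^ (2 * n + 2) ∧
        Jarlskog.haarU3.real {U | |Jarlskog.J U| ≤ y} =
          (Jarlskog.mu 1).real {b | Jarlskog.absJ b ≤ y}) ∧
    -- the flat measure, `k = 3/2`
    (∃ a d : ℕ → ℝ, a 0 = 1680 / Real.pi ∧ d 0 = -(4480 / Real.pi) ∧
      ∀ y : ℝ, 0 < y → y ≤ 1 / (6 * √3) →
        Summable (fun n : ℕ => a n * y ^ (2 * n + 3)) ∧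
        Summable (fun n : ℕ => d n * y ^ (2 * n + 3)) ∧
        (Jarlskog.mu (3 / 2)).real {b | Jarlskog.absJ b ≤ y} =
          420 * y ^ 2
            + Real.log (4 * y ^ 2) * ∑' n : ℕ, a n * y ^ (2 * n + 3)
            + ∑' n : ℕ, d n * y ^ (2 * n + 3)) := by
  refine ⟨fun k hk => ⟨Jarlskog.isProbabilityMeasure_mu hk, fun x hx hx1 =>
    ⟨Jarlskog.summable_cdfTerm hk hx hx1, Jarlskog.mu_real_absJ_le hk hx hx1,
      Jarlskog.mu_real_absJ_lt hk hx hx1⟩⟩, ?_, Jarlskog.mu_three_halves_series⟩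
  obtain ⟨a, d, h0, h1, h2, h3, h4, h5, h⟩ := Jarlskog.mu_one_series
  refine ⟨a, d, h0, h1, h2, h3, h4, h5, fun y hy hy1 => ?_⟩
  obtain ⟨ha, hd, he⟩ := h y hy hy1
  have hJ := Jarlskog.haarU3_real_abs_J_le hy
  exact ⟨ha, hd, hJ.trans he, hJ⟩
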